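/- Let $Z_i=(W_i,X_i,Y_i)$, $i\ge 1$, be i.i.d. with law $P_0$ on $\mathbb{R}^{d_2}\times\mathbb{R}^{d_1}\times\mathbb{R}$, with $E_0[Y^2]<\infty$. Let $\mathcal{F}$ be a class of measurable functions $f(w,x)$ with $E_0[f(W,X)^2]<\infty$, and let $\mathcal{B}\subset\mathbb{R}$ be a bounded symmetric interval. Put $\mu_{P_0,Y}(w)=E_0[Y\mid W=w]$, $\mu_{P_0,f}(w)=E_0[f(W,X)\mid W=w]$, $$G_{0,f}(\beta)=\int\{y-\mu_{P_0,Y}(w)-\beta f(w,x)\}^2\,dP_0,$$ $$\phi_{0,f}(z;\beta)=\{y-\mu_{P_0,Y}(w)-\beta f(w,x)\}^2+2\beta\{y-\mu_{P_0,Y}(w)\}\mu_{P_0,f}(w)-G_{0,f}(\beta).$$ Let $\mu_{n,Y}$ and $\mu_{n,f}$ ($f\in\mathcal{F}$) be random measurable functions of $w$ (estimators of $\mu_{P_0,Y}$ and $\mu_{P_0,f}$), and put $$G_{n,f}(\beta)=\frac1n\sum_{i=1}^n\{Y_i-\mu_{n,Y}(W_i)-\beta f(W_i,X_i)\}^2,$$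 $$\phi_{n,f}(z;\beta)=\{y-\mu_{n,Y}(w)-\beta f(w,x)\}^2+2\beta\{y-\mu_{n,Y}(w)\}\mu_{n,f}(w)-G_{n,f}(\beta),$$ $$\tilde G_{n,f}(\beta)=G_{n,f}(\beta)+\frac1n\sum_{i=1}^n\phi_{n,f}(Z_i;\beta).$$ Primes denote derivatives in $\beta$, and $o_P$ is understood in outer probability. Suppose that $$\Big[\int\{\mu_{P_0,Y}-\mu_{n,Y}\}^2dP_0\Big]^{1/2}=o_P(n^{-1/4}),\qquad \sup_{f\in\mathcal{F}}\Big|\int\{\mu_{P_0,f}-\mu_{n,f}\}\{\mu_{P_0,Y}-\mu_{n,Y}\}\,dP_0\Big|=o_P(n^{-1/2}),$$ and that the estimators $\mu_{n,f}$ are uniformly consistent: $\sup_{f\in\mathcal{F}}\int\{\mu_{P_0,f}-\mu_{n,f}\}^2dP_0=o_P(1)$. Suppose also that there are $P_0$-Donsker classes $\Phi,\Phi'$ and a $P_0$-Glivenko–Cantelli class $\Phi''$ such that, with probability tending to one, each of the following holds: $\{\phi_{n,f}(\cdot;\beta)-\phi_{0,f}(\cdot;\beta): f\in\mathcal{F},\beta\in\mathcal{B}\}\subset\Phi$,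 $\{\phi'_{n,f}(\cdot;0)-\phi'_{0,f}(\cdot;0): f\in\mathcal{F}\}\subset\Phi'$, and $\{\phi''_{n,f}(\cdot;0)-\phi''_{0,f}(\cdot;0): f\in\mathcal{F}\}\subset\Phi''$. Let $\tilde r_{n,f}(\beta)=\{\tilde G_{n,f}(\beta)-G_{0,f}(\beta)\}-\frac1n\sum_{i=1}^n\phi_{0,f}(Z_i;\beta)$. Then: 1. $\tilde G_{n,f_1}(0)=\tilde G_{n,f_2}(0)$ for all $f_1\ne f_2$ in $\mathcal{F}$; 2. $\sup_{f\in\mathcal{F},\beta\in\mathcal{B}}|\tilde r_{n,f}(\beta)|=o_P(n^{-1/2})$; 3. $\tilde G_{n,f}$ and $\tilde r_{n,f}$ are differentiable in $\beta$, and $\sup_{f\in\mathcal{F},\beta\in\mathcal{B}}|\tilde r'_{n,f}(\beta)|=o_P(n^{-1/2})$; 4. $\tilde G_{n,f}$ and $\tilde r_{n,f}$ are twice differentiable in $\beta$, and $\sup_{f\in\mathcal{F},\beta\in\mathcal{B}}|\tilde r''_{n,f}(\beta)|=o_P(1)$. -/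

import Mathlib

open MeasureTheory ProbabilityTheory Filter Topology
open scoped ENNReal BoundedContinuousFunction

noncomputable section

namespace ImprovementInFit

/-! ### Empirical means and stochastic orders -/

/-- The empirical mean `(1/n) ∑ᵢ g(zᵢ)` of `g` over a sample of size `n`. -/
def empMean {S : Type*} {n : ℕ} (z : Fin n → S) (g : S → ℝ) : ℝ :=
  (n : ℝ)⁻¹ * ∑ i, g (z i)

/-- The first `n` observations, at the sample point `ω`. -/
def sample {Ω S : Type*} (Z : ℕ → Ω → S) (n : ℕ) (ω : Ω) : Fin n → S :=
  fun i => Z i ω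

/-- `X n = o_P(a n)`: for all `ε > 0`, the probability of `X n > ε a n` tends to zero.
A measure is applied to arbitrary sets as an outer measure, so that this is convergence in outer
probability when `X n` is not measurable. -/
def IsLittleOP {Ω : Type*} [MeasurableSpace Ω] (μ : Measure Ω)
    (X : ℕ → Ω → ℝ≥0∞) (a : ℕ → ℝ) : Prop :=
  ∀ ε : ℝ, 0 < ε →
    Tendsto (fun n => μ {ω | ENNReal.ofReal (ε * a n) < X n ω}) atTop (𝓝 0)

/-- The event `E n` holds with probability tending to one (that is, the outer probability of its
complement tends to zero). -/
def WithProbTendingToOne {Ω : Type*} [MeasurableSpace Ω] (μ : Measure Ω)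
    (E : ℕ → Ω → Prop) : Prop :=
  Tendsto (fun n => μ {ω | ¬ E n ω}) atTop (𝓝 0)

/-! ### Donsker and Glivenko–Cantelli classes -/

/-- The space `ℓ^∞(ι)` of bounded real functions on `ι`, with the supremum norm. -/
abbrev EllInfty (ι : Type*) : Type _ := lp (fun _ : ι => ℝ) ∞

instance instMeasurableSpaceEllInfty (ι : Type*) : MeasurableSpace (EllInfty ι) := borel _

instance instBorelSpaceEllInfty (ι : Type*) : BorelSpace (EllInfty ι) := ⟨rfl⟩

/-- The outer expectation of a bounded, possibly non-measurable, function. -/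
def outerExpectation {Ω : Type*} [MeasurableSpace Ω] (μ : Measure Ω) (h : Ω → ℝ) : ℝ :=
  sInf {a : ℝ | ∃ U : Ω → ℝ, Measurable U ∧ Integrable U μ ∧ (∀ ω, h ω ≤ U ω) ∧ a = ∫ ω, U ω ∂μ}

/-- `L` is the law of a tight `P`-Brownian bridge on `ℓ^∞(Φ)`: a tight Borel probability measure,
under which the coordinate process is mean-zero Gaussian with the covariance of the class `Φ`
under `P`. -/
def IsTightBrownianBridge {S : Type*} [MeasurableSpace S] (P : Measure S) (Φ : Set (S → ℝ))
    (L : Measure (EllInfty Φ)) : Prop :=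
  IsProbabilityMeasure L ∧ IsTightMeasureSet {L} ∧
    ∀ (s : Finset Φ) (c : Φ → ℝ),
      L.map (fun x : EllInfty Φ => ∑ φ ∈ s, c φ * x φ) =
        gaussianReal 0 (variance (fun z => ∑ φ ∈ s, c φ * φ.1 z) P).toNNReal

/-- `Φ` is `P`-Donsker: it consists of measurable square-integrable functions, the empirical
processes `√n (P_n - P)` of i.i.d. samples from `P` have bounded sample paths on `Φ`, and they
converge weakly in `ℓ^∞(Φ)` (in the sense of outer expectations of bounded continuous functions)
to a tight `P`-Brownian bridge. -/
def IsDonsker {S : Type*} [MeasurableSpace S] (P : Measure S) (Φ : Set (S → ℝ)) : Prop :=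
  (∀ φ ∈ Φ, Measurable φ ∧ MemLp φ 2 P) ∧
  ∃ (E : ∀ n : ℕ, (Fin n → S) → EllInfty Φ) (L : Measure (EllInfty Φ)),
    (∀ (n : ℕ) (z : Fin n → S) (φ : Φ),
      E n z φ = Real.sqrt n * (empMean z φ.1 - ∫ s, φ.1 s ∂P)) ∧
    IsTightBrownianBridge P Φ L ∧
    ∀ h : EllInfty Φ →ᵇ ℝ,
      Tendsto (fun n : ℕ => outerExpectation (Measure.pi fun _ : Fin n => P) (fun z => h (E n z)))
        atTop (𝓝 (∫ x, h x ∂L))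

/-- `Φ` is `P`-Glivenko–Cantelli: it consists of measurable integrable functions, and
`sup_{φ ∈ Φ} |P_n φ - P φ|` converges to zero outer almost surely, for an i.i.d. sequence
from `P`. -/
def IsGlivenkoCantelli {S : Type*} [MeasurableSpace S] (P : Measure S) [IsProbabilityMeasure P]
    (Φ : Set (S → ℝ)) : Prop :=
  (∀ φ ∈ Φ, Measurable φ ∧ Integrable φ P) ∧
  ∃ Δ : ℕ → (ℕ → S) → ℝ≥0∞,
    (∀ n, Measurable (Δ n)) ∧
    (∀ n z, ∀ φ ∈ Φ,
      ENNReal.ofReal |empMean (fun i : Fin n => z i) φ - ∫ s, φ s ∂P| ≤ Δ n z) ∧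
    ∀ᵐ z ∂(Measure.infinitePi fun _ : ℕ => P), Tendsto (fun n => Δ n z) atTop (𝓝 0)

/-! ### Uniform asymptotic linearity along the sub-models

Below, `𝔉` is the set of directions, `B` the range of the parameter `β`, `Gt n ω f β` an estimator
of the goodness-of-fit `G0 f β`, and `φ0 f z β` the influence function. -/

section Conditions

variable {Ω S D : Type*}

/-- The remainder `{G̃_{n,f}(β) - G_{0,f}(β)} - (1/n) ∑ᵢ φ_{0,f}(Zᵢ; β)`. -/
def remainder (Z : ℕ → Ω → S) (Gt : ℕ → Ω → D → ℝ → ℝ) (G0 : D → ℝ → ℝ)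
    (φ0 : D → S → ℝ → ℝ) (n : ℕ) (ω : Ω) (f : D) (β : ℝ) : ℝ :=
  (Gt n ω f β - G0 f β) - empMean (sample Z n ω) (fun z => φ0 f z β)

/-- The estimators along all sub-models agree at `β = 0`. -/
def AgreeAtZero (𝔉 : Set D) (Gt : ℕ → Ω → D → ℝ → ℝ) : Prop :=
  ∀ n ω, ∀ f₁ ∈ 𝔉, ∀ f₂ ∈ 𝔉, f₁ ≠ f₂ → Gt n ω f₁ 0 = Gt n ω f₂ 0

/-- Uniform asymptotic linearity of the estimator. -/
def UniformlyAsympLinear [MeasurableSpace Ω] (μ : Measure Ω) (Z : ℕ → Ω → S) (𝔉 : Set D) (B : Set ℝ)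
    (Gt : ℕ → Ω → D → ℝ → ℝ) (G0 : D → ℝ → ℝ) (φ0 : D → S → ℝ → ℝ) : Prop :=
  IsLittleOP μ
    (fun n ω => ⨆ f ∈ 𝔉, ⨆ β ∈ B, ENNReal.ofReal |remainder Z Gt G0 φ0 n ω f β|)
    (fun n => (n : ℝ) ^ (-(1 / 2) : ℝ))

/-- The estimator (and the remainder) is differentiable in `β`, and the derivative of
the remainder is uniformly of order `o_P(n^{-1/2})`. -/
def DerivAsympLinear [MeasurableSpace Ω] (μ : Measure Ω) (Z : ℕ → Ω → S) (𝔉 : Set D) (B : Set ℝ)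
    (Gt : ℕ → Ω → D → ℝ → ℝ) (G0 : D → ℝ → ℝ) (φ0 : D → S → ℝ → ℝ) : Prop :=
  (∀ n ω, ∀ f ∈ 𝔉, ∀ β ∈ B, DifferentiableAt ℝ (Gt n ω f) β ∧
    DifferentiableAt ℝ (remainder Z Gt G0 φ0 n ω f) β) ∧
  IsLittleOP μ
    (fun n ω => ⨆ f ∈ 𝔉, ⨆ β ∈ B, ENNReal.ofReal |deriv (remainder Z Gt G0 φ0 n ω f) β|)
    (fun n => (n : ℝ) ^ (-(1 / 2) : ℝ))

/-- The estimator (and the remainder) is twice differentiable in `β`, and the second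
derivative of the remainder is uniformly of order `o_P(1)`. -/
def SecondDerivConsistent [MeasurableSpace Ω] (μ : Measure Ω) (Z : ℕ → Ω → S) (𝔉 : Set D) (B : Set ℝ)
    (Gt : ℕ → Ω → D → ℝ → ℝ) (G0 : D → ℝ → ℝ) (φ0 : D → S → ℝ → ℝ) : Prop :=
  (∀ n ω, ∀ f ∈ 𝔉, ∀ β ∈ B, DifferentiableAt ℝ (deriv (Gt n ω f)) β ∧
    DifferentiableAt ℝ (deriv (remainder Z Gt G0 φ0 n ω f)) β) ∧
  IsLittleOP μ
    (fun n ω => ⨆ f ∈ 𝔉, ⨆ β ∈ B,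
      ENNReal.ofReal |deriv (deriv (remainder Z Gt G0 φ0 n ω f)) β|)
    (fun _ => 1)

end Conditions

/-! ### The nonparametric regression model -/

/-- The covariate space. -/
abbrev Cov (d₂ : ℕ) : Type := EuclideanSpace ℝ (Fin d₂)

/-- The space of predictors of interest. -/
abbrev Pred (d₁ : ℕ) : Type := EuclideanSpace ℝ (Fin d₁)

/-- Observations `z = (w, x, y)`. -/
abbrev Obs (d₁ d₂ : ℕ) : Type := Cov d₂ × (Pred d₁ × ℝ)

/-- Directions `f`, real functions of `(w, x)`. -/
abbrev Dir (d₁ d₂ : ℕ) : Type := Cov d₂ × Pred d₁ → ℝ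

variable {d₁ d₂ : ℕ}

/-- `μ_{P,Y}(w) = E_P[Y | W = w]`, computed with the regular conditional distribution of `(X, Y)`
given `W`. -/
def condMeanY (P : Measure (Obs d₁ d₂)) [IsFiniteMeasure P] (w : Cov d₂) : ℝ :=
  ∫ q, q.2 ∂(P.condKernel w)

/-- `μ_{P,f}(w) = E_P[f(W, X) | W = w]`. -/
def condMeanDir (P : Measure (Obs d₁ d₂)) [IsFiniteMeasure P] (f : Dir d₁ d₂) (w : Cov d₂) : ℝ :=
  ∫ q, f (w, q.1) ∂(P.condKernel w)

/-- The squared error `{y - m(w) - β f(w, x)}²`. -/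
def sqLoss (m : Cov d₂ → ℝ) (f : Dir d₁ d₂) (β : ℝ) (z : Obs d₁ d₂) : ℝ :=
  (z.2.2 - m z.1 - β * f (z.1, z.2.1)) ^ 2

/-- `G_{P,f}(β) = ∫ {y - μ_{P,Y}(w) - β f(w, x)}² dP`. -/
def goodnessOfFit (P : Measure (Obs d₁ d₂)) [IsFiniteMeasure P] (f : Dir d₁ d₂) (β : ℝ) : ℝ :=
  ∫ z, sqLoss (condMeanY P) f β z ∂P

/-- `{y - m(w) - β f(w,x)}² + 2 β {y - m(w)} m_f(w) - G(β)`: the influence function of the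
goodness-of-fit at nuisance values `m`, `m_f`, `G`. -/
def influence (m mf : Cov d₂ → ℝ) (G : ℝ → ℝ) (f : Dir d₁ d₂) (z : Obs d₁ d₂) (β : ℝ) : ℝ :=
  sqLoss m f β z + 2 * β * (z.2.2 - m z.1) * mf z.1 - G β

/-- The efficient influence function `φ_{P,f}(z; β)` of `G_{P,f}(β)`. -/
def effInfluence (P : Measure (Obs d₁ d₂)) [IsFiniteMeasure P] (f : Dir d₁ d₂)
    (z : Obs d₁ d₂) (β : ℝ) : ℝ :=
  influence (condMeanY P) (condMeanDir P f) (goodnessOfFit P f) f z β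

section Estimators

variable {Ω : Type*} (Z : ℕ → Ω → Obs d₁ d₂) (mY : ℕ → Ω → Cov d₂ → ℝ)
  (mF : ℕ → Ω → Dir d₁ d₂ → Cov d₂ → ℝ)

/-- The plug-in estimator `G_{n,f}(β) = (1/n) ∑ᵢ {Yᵢ - μ_{n,Y}(Wᵢ) - β f(Wᵢ, Xᵢ)}²`. -/
def plugIn (n : ℕ) (ω : Ω) (f : Dir d₁ d₂) (β : ℝ) : ℝ :=
  empMean (sample Z n ω) (sqLoss (mY n ω) f β)

/-- The estimated influence function `φ_{n,f}(z; β)`. -/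
def estInfluence (n : ℕ) (ω : Ω) (f : Dir d₁ d₂) (z : Obs d₁ d₂) (β : ℝ) : ℝ :=
  influence (mY n ω) (mF n ω f) (plugIn Z mY n ω f) f z β

/-- The one-step estimator `G̃_{n,f}(β) = G_{n,f}(β) + (1/n) ∑ᵢ φ_{n,f}(Zᵢ; β)`. -/
def oneStep (n : ℕ) (ω : Ω) (f : Dir d₁ d₂) (β : ℝ) : ℝ :=
  plugIn Z mY n ω f β + empMean (sample Z n ω) (fun z => estInfluence Z mY mF n ω f z β)

end Estimators

end ImprovementInFit

end

/-!
In `β` the remainder is affine: it is the empirical mean of the error made in the influence function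
by estimating the conditional means, with intercept and slope of the same kind. By orthogonality of
`Y - E[Y | W]` and `f - E[f | W]` to functions of `W`, the mean of this error is of second order in
the nuisance errors, hence `o_P(n^{-1/2})`.

The centred empirical mean is negligible by asymptotic equicontinuity once the variances of the
errors vanish. As `𝔉` need not be bounded in `L²`, this does not follow from Hölder's inequality. Up
to an `L¹`-small term the error is a product `d u_f`, where `d = E[Y | W] - m` tends to zero. A
tight Brownian bridge forces the centred Donsker class to be totally bounded in `L²`, so if the
variances did not vanish, some `d_k u_k` would converge to a nonzero limit, almost everywhere along
a subsequence, while `(d_j u_k)_k` stays bounded in `L¹` for each `j`; since `d_k → 0`, this is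
impossible.
-/

noncomputable section

namespace ImprovementInFit

/-! ### Stochastic orders and outer expectations -/

section OuterProbability

variable {Ω : Type*} [MeasurableSpace Ω] {μ : Measure Ω}

theorem WithProbTendingToOne.and {E F : ℕ → Ω → Prop} (hE : WithProbTendingToOne μ E)
    (hF : WithProbTendingToOne μ F) : WithProbTendingToOne μ (fun n ω => E n ω ∧ F n ω) := by
  have hadd : Tendsto (fun n => μ {ω | ¬ E n ω} + μ {ω | ¬ F n ω}) atTop (𝓝 0) := by
    simpa using hE.add hF
  refine tendsto_of_tendsto_of_tendsto_of_le_of_le tendsto_const_nhds hadd (fun _ => zero_le)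
    fun n => (measure_mono fun ω hω => ?_).trans (measure_union_le _ _)
  exact not_and_or.1 hω

theorem WithProbTendingToOne.mono {E F : ℕ → Ω → Prop} (hE : WithProbTendingToOne μ E)
    (h : ∀ᶠ n in atTop, ∀ ω, E n ω → F n ω) : WithProbTendingToOne μ F := by
  refine tendsto_of_tendsto_of_tendsto_of_le_of_le' tendsto_const_nhds hE
    (Eventually.of_forall fun _ => zero_le) ?_
  filter_upwards [h] with n hn
  exact measure_mono fun ω hω hE => hω (hn ω hE)

theorem withProbTendingToOne_iff_measureReal [IsFiniteMeasure μ] {E : ℕ → Ω → Prop} :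
    WithProbTendingToOne μ E ↔ ∀ η : ℝ, 0 < η → ∀ᶠ n in atTop, μ.real {ω | ¬ E n ω} ≤ η := by
  rw [WithProbTendingToOne, ← ENNReal.tendsto_toReal_zero_iff fun _ => measure_ne_top _ _]
  refine ⟨fun h η hη => h.eventually_le_const hη, fun h => tendsto_order.2 ⟨fun a ha => ?_,
    fun a ha => ?_⟩⟩
  · exact Eventually.of_forall fun _ => ha.trans_le ENNReal.toReal_nonneg
  · exact (h (a / 2) (half_pos ha)).mono fun n hn => hn.trans_lt (half_lt_self ha)

theorem isLittleOP_iff {X : ℕ → Ω → ℝ≥0∞} {a : ℕ → ℝ} :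
    IsLittleOP μ X a ↔
      ∀ ε : ℝ, 0 < ε → WithProbTendingToOne μ fun n ω => X n ω ≤ ENNReal.ofReal (ε * a n) := by
  simp only [IsLittleOP, WithProbTendingToOne, not_le]

theorem isLittleOP_biSup_iff {ι : Type*} {I : Set ι} {X : ℕ → Ω → ι → ℝ≥0∞} {a : ℕ → ℝ} :
    IsLittleOP μ (fun n ω => ⨆ i ∈ I, X n ω i) a ↔
      ∀ ε : ℝ, 0 < ε →
        WithProbTendingToOne μ fun n ω => ∀ i ∈ I, X n ω i ≤ ENNReal.ofReal (ε * a n) := by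
  simp only [isLittleOP_iff, iSup₂_le_iff]

theorem mul_measureReal_ge_le_outerExpectation [IsFiniteMeasure μ] {h : Ω → ℝ} {C c : ℝ}
    (h_nonneg : ∀ ω, 0 ≤ h ω) (h_le : ∀ ω, h ω ≤ C) (hc : 0 ≤ c) :
    c * μ.real {ω | c ≤ h ω} ≤ outerExpectation μ h := by
  refine le_csInf ⟨_, fun _ => C, measurable_const, integrable_const C, h_le, rfl⟩ ?_
  rintro _ ⟨U, -, hU, hle, rfl⟩
  calc c * μ.real {ω | c ≤ h ω} ≤ c * μ.real {ω | c ≤ U ω} := by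
        refine mul_le_mul_of_nonneg_left (measureReal_mono ?_) hc
        exact fun ω (hω : c ≤ h ω) => hω.trans (hle ω)
    _ ≤ ∫ ω, U ω ∂μ :=
        mul_meas_ge_le_integral_of_nonneg
          (Eventually.of_forall fun ω => (h_nonneg ω).trans (hle ω)) hU c

/-- One half of the portmanteau theorem for weak convergence in the sense of outer expectations. -/
theorem eventually_measureReal_preimage_lt {M : Type*} [PseudoMetricSpace M] [MeasurableSpace M]
    [OpensMeasurableSpace M] {L : Measure M} [IsFiniteMeasure L] {Ω : ℕ → Type*}
    [∀ n, MeasurableSpace (Ω n)] {ν : ∀ n, Measure (Ω n)} [∀ n, IsFiniteMeasure (ν n)]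
    {E : ∀ n, Ω n → M}
    (hconv : ∀ h : M →ᵇ ℝ, Tendsto (fun n => outerExpectation (ν n) fun z => h (E n z)) atTop
      (𝓝 (∫ x, h x ∂L)))
    {F : Set M} {δ η : ℝ} (hδ : 0 < δ) (hF : L.real (Metric.thickening δ F) < η) :
    ∀ᶠ n in atTop, (ν n).real (E n ⁻¹' F) < η := by
  let k : M →ᵇ ℝ := (thickenedIndicator hδ F).comp _ (LipschitzWith.subtype_val _)
  have hk_le (x : M) : k x ≤ 1 := mod_cast thickenedIndicator_le_one hδ F x
  have hk_int : ∫ x, k x ∂L ≤ L.real (Metric.thickening δ F) := by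
    rw [← integral_indicator_one Metric.isOpen_thickening.measurableSet]
    refine integral_mono (k.integrable L)
      ((integrable_const 1).indicator Metric.isOpen_thickening.measurableSet) fun x => ?_
    by_cases hx : x ∈ Metric.thickening δ F
    · simpa [hx] using hk_le x
    · have hkx : k x = 0 := congrArg NNReal.toReal (thickenedIndicator_zero hδ F hx)
      simp [hx, hkx]
  filter_upwards [(hconv k).eventually_lt_const (hk_int.trans_lt hF)] with n hn
  refine lt_of_le_of_lt ?_ hn
  calc (ν n).real (E n ⁻¹' F) ≤ 1 * (ν n).real {z | 1 ≤ k (E n z)} := by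
        rw [one_mul]
        exact measureReal_mono fun z hz =>
          (congrArg NNReal.toReal (thickenedIndicator_one hδ F hz)).ge
    _ ≤ outerExpectation (ν n) fun z => k (E n z) :=
        mul_measureReal_ge_le_outerExpectation (fun z => NNReal.coe_nonneg _)
          (fun z => hk_le _) zero_le_one

theorem exists_finite_measureReal_compl_biUnion_ball_le {M : Type*} [PseudoMetricSpace M]
    [MeasurableSpace M] {L : Measure M} [IsFiniteMeasure L] (hL : IsTightMeasureSet {L}) {r η : ℝ}
    (hr : 0 < r) (hη : 0 < η) :
    ∃ t : Finset M, L.real (⋃ y ∈ t, Metric.ball y r)ᶜ ≤ η := by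
  obtain ⟨K, hK, hKL⟩ := isTightMeasureSet_iff_exists_isCompact_measure_compl_le.1 hL
    (ENNReal.ofReal η) (by positivity)
  obtain ⟨t, -, htfin, ht⟩ := finite_cover_balls_of_compact hK hr
  have hsub : (⋃ y ∈ htfin.toFinset, Metric.ball y r)ᶜ ⊆ Kᶜ :=
    Set.compl_subset_compl.2 (by simpa using ht)
  exact ⟨htfin.toFinset, (measureReal_mono hsub).trans
    (ENNReal.toReal_le_of_le_ofReal hη.le (hKL L rfl))⟩

theorem measureReal_sample_mem_le {S : Type*} [MeasurableSpace S] {P : Measure S}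
    [IsProbabilityMeasure P] [IsProbabilityMeasure μ] {Z : ℕ → Ω → S}
    (hZ : ∀ i, AEMeasurable (Z i) μ) (hindep : iIndepFun Z μ) (hlaw : ∀ i, μ.map (Z i) = P)
    (n : ℕ) (A : Set (Fin n → S)) :
    μ.real {ω | sample Z n ω ∈ A} ≤ (Measure.pi fun _ : Fin n => P).real A := by
  have hmap : μ.map (sample Z n) = Measure.pi fun _ : Fin n => P := by
    have h := (iIndepFun_iff_map_fun_eq_pi_map fun i : Fin n => hZ i).1
      (hindep.precomp Fin.val_injective)
    simp only [hlaw] at h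
    exact h
  have hmeas : AEMeasurable (sample Z n) μ := aemeasurable_pi_lambda _ fun i => hZ i
  rw [← hmap]
  refine ENNReal.toReal_mono ?_ (Measure.le_map_apply hmeas A)
  rw [hmap]
  exact measure_ne_top _ _

theorem enorm_integral_le_eLpNorm {S : Type*} [MeasurableSpace S] {P : Measure S}
    [IsProbabilityMeasure P] {R : S → ℝ} {p : ℝ≥0∞} (hp : 1 ≤ p) (hR : AEStronglyMeasurable R P) :
    ‖∫ s, R s ∂P‖ₑ ≤ eLpNorm R p P := by
  refine (enorm_integral_le_lintegral_enorm R).trans ?_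
  rw [← eLpNorm_one_eq_lintegral_enorm]
  exact eLpNorm_le_eLpNorm_of_exponent_le hp hR

theorem eLpNorm_sub_integral_le {S : Type*} [MeasurableSpace S] {P : Measure S}
    [IsProbabilityMeasure P] {R : S → ℝ} {p : ℝ≥0∞} (hp : 1 ≤ p) (hR : AEStronglyMeasurable R P) :
    eLpNorm (fun s => R s - ∫ t, R t ∂P) p P ≤ 2 * eLpNorm R p P := by
  have hmean : eLpNorm (fun _ : S => ∫ t, R t ∂P) p P ≤ eLpNorm R p P := by
    rw [eLpNorm_const _ (zero_lt_one.trans_le hp).ne' (NeZero.ne P), measure_univ, ENNReal.one_rpow,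
      mul_one]
    exact enorm_integral_le_eLpNorm hp hR
  calc _ ≤ eLpNorm R p P + eLpNorm (fun _ : S => ∫ t, R t ∂P) p P :=
        eLpNorm_sub_le hR aestronglyMeasurable_const hp
    _ ≤ 2 * eLpNorm R p P := by rw [two_mul]; gcongr

theorem eLpNorm_sub_centred_add_le {S : Type*} [MeasurableSpace S] {P : Measure S}
    [IsProbabilityMeasure P] {g R : S → ℝ} {p : ℝ≥0∞} (hp : 1 ≤ p) (hg : Integrable g P)
    (hg_zero : ∫ s, g s ∂P = 0) (hR : Integrable R P) (c : ℝ) :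
    eLpNorm (fun s => g s - (g s + R s - c - ∫ t, (g t + R t - c) ∂P)) p P ≤
      2 * eLpNorm R p P := by
  have hint : ∫ t, (g t + R t - c) ∂P = (∫ t, R t ∂P) - c := by
    rw [integral_sub (f := fun s => g s + R s) (hg.add hR) (integrable_const c), integral_add hg hR,
      hg_zero, zero_add, integral_const, probReal_univ, one_smul]
  have hneg : (fun s => g s - (g s + R s - c - ∫ t, (g t + R t - c) ∂P)) =
      -fun s => R s - ∫ t, R t ∂P := by
    ext s
    simp only [hint, Pi.neg_apply]
    ring
  rw [hneg, eLpNorm_neg]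
  exact eLpNorm_sub_integral_le hp hR.1

end OuterProbability

/-! ### Tight Brownian bridges -/

theorem gaussianPDFReal_le (m : ℝ) (v : NNReal) (x : ℝ) : gaussianPDFReal m v x ≤ (√v)⁻¹ := by
  rcases eq_or_ne v 0 with rfl | hv
  · simp
  have hexp : Real.exp (-(x - m) ^ 2 / (2 * v)) ≤ 1 := by
    rw [Real.exp_le_one_iff, neg_div]
    exact neg_nonpos.2 (by positivity)
  have hsqrt : (√(2 * Real.pi * v))⁻¹ ≤ (√v)⁻¹ := by
    refine inv_anti₀ (by positivity) (Real.sqrt_le_sqrt ?_)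
    exact le_mul_of_one_le_left v.2 (by linarith [Real.pi_gt_three])
  rw [gaussianPDFReal]
  exact (mul_le_of_le_one_right (by positivity) hexp).trans hsqrt

theorem measureReal_gaussianReal_Icc_le (m : ℝ) {v : NNReal} (hv : v ≠ 0) {a b : ℝ} (hab : a ≤ b) :
    (gaussianReal m v).real (Set.Icc a b) ≤ (b - a) / √v := by
  refine ENNReal.toReal_le_of_le_ofReal (div_nonneg (sub_nonneg.2 hab) (Real.sqrt_nonneg _)) ?_
  calc gaussianReal m v (Set.Icc a b) = ∫⁻ x in Set.Icc a b, gaussianPDF m v x :=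
        gaussianReal_apply m hv _
    _ ≤ ∫⁻ _ in Set.Icc a b, ENNReal.ofReal (√v)⁻¹ :=
        lintegral_mono fun x => ENNReal.ofReal_le_ofReal (gaussianPDFReal_le m v x)
    _ = ENNReal.ofReal ((b - a) / √v) := by
        rw [setLIntegral_const, Real.volume_Icc, ← ENNReal.ofReal_mul (by positivity),
          div_eq_inv_mul]

theorem EllInfty.abs_apply_sub_le {ι : Type*} (x y : EllInfty ι) (i : ι) :
    |x i - y i| ≤ dist x y := by
  rw [dist_eq_norm]
  exact lp.norm_apply_le_norm ENNReal.top_ne_zero (x - y) i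

theorem EllInfty.continuous_apply {ι : Type*} (i : ι) : Continuous fun x : EllInfty ι => x i := by
  refine (LipschitzWith.of_dist_le_mul (K := 1) fun x y => ?_).continuous
  simpa [Real.dist_eq] using EllInfty.abs_apply_sub_le x y i

section Bridge

variable {S : Type*} [MeasurableSpace S] {P : Measure S} {Φ : Set (S → ℝ)}
  {L : Measure (EllInfty Φ)}

/-- The elements of `ℓ^∞(Φ)` that are at least `ε` in absolute value at some function of variance
at most `ρ`. Asymptotic equicontinuity says that an empirical process eventually avoids this set. -/
def exceedanceSet (P : Measure S) (Φ : Set (S → ℝ)) (ρ ε : ℝ) : Set (EllInfty Φ) :=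
  {x | ∃ φ : Φ, Var[φ.1; P] ≤ ρ ∧ ε ≤ |x φ|}

theorem thickening_exceedanceSet_subset (ρ ε δ : ℝ) :
    Metric.thickening δ (exceedanceSet P Φ ρ ε) ⊆ exceedanceSet P Φ ρ (ε - δ) := by
  intro x hx
  obtain ⟨y, ⟨φ, hφ, hy⟩, hxy⟩ := Metric.mem_thickening_iff.1 hx
  refine ⟨φ, hφ, ?_⟩
  have hdist := EllInfty.abs_apply_sub_le y x φ
  rw [dist_comm] at hdist
  linarith [abs_sub_abs_le_abs_sub (y φ) (x φ)]

namespace IsTightBrownianBridge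

theorem map_apply (h : IsTightBrownianBridge P Φ L) (φ : Φ) :
    L.map (fun x : EllInfty Φ => x φ) = gaussianReal 0 Var[φ.1; P].toNNReal := by
  simpa using h.2.2 {φ} (fun _ => 1)

theorem map_sub (h : IsTightBrownianBridge P Φ L) {φ ψ : Φ} (hne : φ ≠ ψ) :
    L.map (fun x : EllInfty Φ => x φ - x ψ) =
      gaussianReal 0 Var[fun z => φ.1 z - ψ.1 z; P].toNNReal := by
  classical
  have hlaw := h.2.2 {φ, ψ} (fun χ => if χ = φ then 1 else -1)
  simpa [Finset.sum_pair hne, hne.symm, sub_eq_add_neg] using hlaw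

theorem measureReal_le_abs_apply_le (h : IsTightBrownianBridge P Φ L) (φ : Φ) {ε : ℝ}
    (hε : 0 < ε) : L.real {x | ε ≤ |x φ|} ≤ Var[φ.1; P] / ε ^ 2 := by
  have hcheb := meas_ge_le_variance_div_sq (μ := gaussianReal 0 Var[φ.1; P].toNNReal) (X := id)
    (memLp_id_gaussianReal' 2 (by simp)) hε
  simp only [variance_id_gaussianReal, integral_id_gaussianReal, id_eq, sub_zero,
    Real.coe_toNNReal _ (variance_nonneg _ _)] at hcheb
  have hmeas : MeasurableSet {r : ℝ | ε ≤ |r|} := measurableSet_le measurable_const measurable_norm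
  rw [← h.map_apply, Measure.map_apply (EllInfty.continuous_apply φ).measurable hmeas] at hcheb
  exact ENNReal.toReal_le_of_le_ofReal (div_nonneg (variance_nonneg _ _) (sq_nonneg _)) hcheb

theorem measureReal_ball_inter_exceedanceSet_le (h : IsTightBrownianBridge P Φ L)
    (y : EllInfty Φ) {ρ ε : ℝ} (hρ : 0 ≤ ρ) (hε : 0 < ε) :
    L.real (Metric.ball y (ε / 4) ∩ exceedanceSet P Φ ρ ε) ≤ 4 * ρ / ε ^ 2 := by
  have := h.1
  rcases (Metric.ball y (ε / 4) ∩ exceedanceSet P Φ ρ ε).eq_empty_or_nonempty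
    with hempty | ⟨x₀, hx₀, φ, hφ, hφx₀⟩
  · rw [hempty, measureReal_empty]
    positivity
  -- All points of the ball are within `ε / 2` of `x₀`, so they are large at the same function.
  have hsub : Metric.ball y (ε / 4) ∩ exceedanceSet P Φ ρ ε ⊆ {x | ε / 2 ≤ |x φ|} := by
    rintro x ⟨hx, -⟩
    have hdist : dist x₀ x < ε / 4 + ε / 4 :=
      (dist_triangle_right x₀ x y).trans_lt (add_lt_add hx₀ hx)
    have habs := EllInfty.abs_apply_sub_le x₀ x φ
    have htri := abs_sub_abs_le_abs_sub (x₀ φ) (x φ)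
    rw [Set.mem_ofPred_eq]
    linarith
  calc _ ≤ L.real {x | ε / 2 ≤ |x φ|} := measureReal_mono hsub
    _ ≤ Var[φ.1; P] / (ε / 2) ^ 2 := h.measureReal_le_abs_apply_le φ (half_pos hε)
    _ ≤ ρ / (ε / 2) ^ 2 := by gcongr
    _ = 4 * ρ / ε ^ 2 := by ring

theorem exists_measureReal_exceedanceSet_le (h : IsTightBrownianBridge P Φ L) {ε η : ℝ}
    (hε : 0 < ε) (hη : 0 < η) : ∃ ρ : ℝ, 0 < ρ ∧ L.real (exceedanceSet P Φ ρ ε) ≤ η := by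
  have := h.1
  obtain ⟨t, ht⟩ := exists_finite_measureReal_compl_biUnion_ball_le h.2.1
    (show 0 < ε / 4 by positivity) (half_pos hη)
  set ρ : ℝ := η * ε ^ 2 / (8 * (t.card + 1)) with hρ
  have hρ0 : 0 < ρ := by positivity
  refine ⟨ρ, hρ0, ?_⟩
  set F := exceedanceSet P Φ ρ ε
  have hcover : F ⊆ (⋃ y ∈ t, Metric.ball y (ε / 4))ᶜ ∪ ⋃ y ∈ t, Metric.ball y (ε / 4) ∩ F := by
    rw [← Set.iUnion₂_inter]
    exact fun x hx => (em' _).imp_right fun hxt => ⟨hxt, hx⟩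
  calc L.real F ≤ L.real (⋃ y ∈ t, Metric.ball y (ε / 4))ᶜ
        + L.real (⋃ y ∈ t, Metric.ball y (ε / 4) ∩ F) :=
        (measureReal_mono hcover).trans (measureReal_union_le _ _)
    _ ≤ η / 2 + ∑ y ∈ t, 4 * ρ / ε ^ 2 := by
        refine add_le_add ht ((measureReal_biUnion_finset_le _ _).trans (Finset.sum_le_sum ?_))
        exact fun y _ => h.measureReal_ball_inter_exceedanceSet_le y hρ0.le hε
    _ = η / 2 + t.card / (t.card + 1) * (η / 2) := by
        rw [Finset.sum_const, nsmul_eq_mul, hρ]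
        field_simp
        ring
    _ ≤ η / 2 + 1 * (η / 2) := by
        gcongr
        exact div_le_one_of_le₀ (by linarith) (by positivity)
    _ = η := by ring

theorem sqrt_variance_sub_le (h : IsTightBrownianBridge P Φ L) {φ ψ : Φ} {a : ℝ}
    (ha : 1 / 2 ≤ L.real {x | |x φ - x ψ| ≤ a}) :
    √Var[fun z => φ.1 z - ψ.1 z; P] ≤ 4 * a := by
  have ha0 : 0 ≤ a := by
    by_contra! hlt
    have hempty : {x : EllInfty Φ | |x φ - x ψ| ≤ a} = ∅ :=
      Set.eq_empty_of_forall_notMem fun x hx => absurd (abs_nonneg _) (not_le.2 (hx.trans_lt hlt))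
    rw [hempty, measureReal_empty] at ha
    norm_num at ha
  rcases (variance_nonneg (fun z => φ.1 z - ψ.1 z) P).eq_or_lt' with hv | hv
  · rw [hv, Real.sqrt_zero]
    positivity
  have hne : φ ≠ ψ := by
    rintro rfl
    have hzero : Var[fun _ : S => (0 : ℝ); P] = 0 := variance_zero P
    simp [hzero] at hv
  have hcont : Continuous fun x : EllInfty Φ => x φ - x ψ :=
    (EllInfty.continuous_apply φ).sub (EllInfty.continuous_apply ψ)
  have hIcc := measureReal_gaussianReal_Icc_le 0 (Real.toNNReal_pos.2 hv).ne' (neg_le_self ha0)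
  rw [← h.map_sub hne, map_measureReal_apply hcont.measurable measurableSet_Icc,
    Real.coe_toNNReal _ hv.le] at hIcc
  have hset : {x : EllInfty Φ | |x φ - x ψ| ≤ a} =
      (fun x : EllInfty Φ => x φ - x ψ) ⁻¹' Set.Icc (-a) a := by
    ext x
    exact abs_le (a := x φ - x ψ)
  rw [hset] at ha
  have hhalf := ha.trans hIcc
  rw [le_div_iff₀ (Real.sqrt_pos.2 hv)] at hhalf
  linarith

end IsTightBrownianBridge

end Bridge

/-! ### Donsker classes -/

theorem exists_finite_cover_ball_of_totallyBounded_range {X Y : Type*} [PseudoMetricSpace X]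
    [PseudoMetricSpace Y] {T : Set X} {V : T → Y} (hV : TotallyBounded (Set.range V)) {r ε : ℝ}
    (hr : 0 < r) (hdist : ∀ g h, dist (V g) (V h) < r → dist (g : X) h < ε) :
    ∃ t : Set X, t.Finite ∧ T ⊆ ⋃ y ∈ t, Metric.ball y ε := by
  obtain ⟨s, hsV, hsfin, hs⟩ := Metric.finite_approx_of_totallyBounded hV r hr
  choose q hq using fun v : s => hsV v.2
  have := hsfin.to_subtype
  refine ⟨Set.range fun v => (q v : X), Set.finite_range _, fun g hg => ?_⟩
  obtain ⟨v, hv, hgv⟩ := Set.mem_iUnion₂.1 (hs ⟨⟨g, hg⟩, rfl⟩)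
  refine Set.mem_iUnion₂.2 ⟨q ⟨v, hv⟩, ⟨⟨v, hv⟩, rfl⟩, hdist ⟨g, hg⟩ (q ⟨v, hv⟩) ?_⟩
  rwa [hq]

theorem EllInfty.totallyBounded_range_eval {ι κ : Type*} (t : Finset (EllInfty ι)) (q : κ → ι) :
    TotallyBounded (Set.range fun (k : κ) (y : t) => y.1 (q k)) := by
  refine (isCompact_Icc (a := fun y : t => -‖y.1‖) (b := fun y => ‖y.1‖)).totallyBounded.subset ?_
  rintro _ ⟨k, rfl⟩
  rw [Set.mem_Icc, Pi.le_def, Pi.le_def, ← forall_and]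
  exact fun y => abs_le.1 (lp.norm_apply_le_norm ENNReal.top_ne_zero y.1 (q k))

section Donsker

variable {S : Type*} [MeasurableSpace S] {P : Measure S} {Φ : Set (S → ℝ)}

/-- The centred class `{φ - Pφ : φ ∈ Φ}`, modulo `P`-null functions, as a subset of `L²(P)`; there
the standard-deviation semimetric on `Φ` becomes the norm distance. -/
def centredClass (P : Measure S) (Φ : Set (S → ℝ)) : Set (Lp ℝ 2 P) :=
  {g | ∃ φ ∈ Φ, g =ᵐ[P] fun z => φ z - ∫ s, φ s ∂P}

theorem norm_eq_sqrt_variance {φ : S → ℝ} (hφ : AEMeasurable φ P) {g : Lp ℝ 2 P}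
    (hg : g =ᵐ[P] fun z => φ z - ∫ s, φ s ∂P) : ‖g‖ = √Var[φ; P] := by
  rw [norm_eq_sqrt_real_inner, L2.inner_def, variance_eq_integral hφ]
  congr 1
  refine integral_congr_ae ?_
  filter_upwards [hg] with z hz
  simp [hz, sq]

theorem dist_eq_sqrt_variance_sub {φ ψ : S → ℝ} (hφ : Integrable φ P) (hψ : Integrable ψ P)
    {g h : Lp ℝ 2 P} (hg : g =ᵐ[P] fun z => φ z - ∫ s, φ s ∂P)
    (hh : h =ᵐ[P] fun z => ψ z - ∫ s, ψ s ∂P) :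
    dist g h = √Var[fun z => φ z - ψ z; P] := by
  rw [dist_eq_norm]
  refine norm_eq_sqrt_variance (φ := fun z => φ z - ψ z) (hφ.sub hψ).aemeasurable ?_
  rw [integral_sub hφ hψ]
  filter_upwards [hg, hh, Lp.coeFn_sub g h] with z hgz hhz hsub
  rw [hsub, Pi.sub_apply, hgz, hhz]
  ring

theorem IsTightBrownianBridge.sqrt_variance_sub_le_of_cover {L : Measure (EllInfty Φ)}
    (h : IsTightBrownianBridge P Φ L) {t : Finset (EllInfty Φ)} {r : ℝ}
    (ht : L.real (⋃ y ∈ t, Metric.ball y r)ᶜ ≤ 1 / 2) {φ ψ : Φ}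
    (hφψ : ∀ y ∈ t, |y φ - y ψ| ≤ r) :
    √Var[fun z => φ.1 z - ψ.1 z; P] ≤ 12 * r := by
  have := h.1
  have hsub : ⋃ y ∈ t, Metric.ball y r ⊆ {x : EllInfty Φ | |x φ - x ψ| ≤ 3 * r} := by
    refine Set.iUnion₂_subset fun y hy x hx => ?_
    rw [Metric.mem_ball] at hx
    rw [Set.mem_ofPred_eq, abs_le]
    have habsφ := abs_le.1 (EllInfty.abs_apply_sub_le x y φ)
    have habsψ := abs_le.1 (EllInfty.abs_apply_sub_le x y ψ)
    have habs := abs_le.1 (hφψ y hy)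
    constructor <;> linarith
  have hcover : 1 / 2 ≤ L.real (⋃ y ∈ t, Metric.ball y r) := by
    have hadd := probReal_compl_eq_one_sub (μ := L)
      (t.measurableSet_biUnion fun y _ => (Metric.isOpen_ball (x := y) (ε := r)).measurableSet)
    linarith
  calc _ ≤ 4 * (3 * r) := h.sqrt_variance_sub_le (hcover.trans (measureReal_mono hsub))
    _ = 12 * r := by ring

theorem IsTightBrownianBridge.totallyBounded_centredClass {L : Measure (EllInfty Φ)}
    (h : IsTightBrownianBridge P Φ L) (hΦ : ∀ φ ∈ Φ, Integrable φ P) :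
    TotallyBounded (centredClass P Φ) := by
  have := h.1
  refine Metric.totallyBounded_iff.2 fun ε hε => ?_
  have hr : 0 < ε / 24 := by positivity
  obtain ⟨t, ht⟩ := exists_finite_measureReal_compl_biUnion_ball_le h.2.1 hr one_half_pos
  choose φ hφΦ hφ using fun g : centredClass P Φ => g.2
  refine exists_finite_cover_ball_of_totallyBounded_range
    (EllInfty.totallyBounded_range_eval t fun g => ⟨φ g, hφΦ g⟩) hr fun g g' hgg' => ?_
  rw [dist_eq_sqrt_variance_sub (hΦ _ (hφΦ g)) (hΦ _ (hφΦ g')) (hφ g) (hφ g')]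
  refine (h.sqrt_variance_sub_le_of_cover ht (φ := ⟨φ g, hφΦ g⟩) (ψ := ⟨φ g', hφΦ g'⟩)
    fun y hy => ?_).trans_lt (show 12 * (ε / 24) < ε by linarith)
  exact ((dist_pi_lt_iff hr).1 hgg' ⟨y, hy⟩).le

theorem IsDonsker.totallyBounded_centredClass [IsFiniteMeasure P] (h : IsDonsker P Φ) :
    TotallyBounded (centredClass P Φ) := by
  obtain ⟨hΦ, -, L, -, hL, -⟩ := h
  exact hL.totallyBounded_centredClass fun φ hφ => (hΦ φ hφ).2.integrable one_le_two

theorem IsDonsker.exists_eventually_measureReal_lt [IsProbabilityMeasure P] (h : IsDonsker P Φ)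
    {ε η : ℝ} (hε : 0 < ε) (hη : 0 < η) :
    ∃ ρ : ℝ, 0 < ρ ∧ ∀ᶠ n : ℕ in atTop, (Measure.pi fun _ : Fin n => P).real
      {z | ∃ φ ∈ Φ, Var[φ; P] ≤ ρ ∧ ε < |√n * (empMean z φ - ∫ s, φ s ∂P)|} < η := by
  obtain ⟨-, E, L, hE, hL, hconv⟩ := h
  have := hL.1
  obtain ⟨ρ, hρ, hLρ⟩ := hL.exists_measureReal_exceedanceSet_le (half_pos hε) (half_pos hη)
  have hthick : L.real (Metric.thickening (ε / 2) (exceedanceSet P Φ ρ ε)) < η := by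
    refine ((measureReal_mono (thickening_exceedanceSet_subset ρ ε (ε / 2))).trans ?_).trans_lt
      (half_lt_self hη)
    rwa [sub_half]
  refine ⟨ρ, hρ, ?_⟩
  filter_upwards [eventually_measureReal_preimage_lt hconv (half_pos hε) hthick] with n hn
  refine (measureReal_mono ?_).trans_lt hn
  rintro z ⟨φ, hφ, hvar, hz⟩
  exact ⟨⟨φ, hφ⟩, hvar, by rw [hE]; exact hz.le⟩

theorem IsDonsker.withProbTendingToOne_abs_le [IsProbabilityMeasure P] (h : IsDonsker P Φ)
    {Ω : Type*} [MeasurableSpace Ω] {μ : Measure Ω} [IsProbabilityMeasure μ] {Z : ℕ → Ω → S}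
    (hZ : ∀ i, AEMeasurable (Z i) μ) (hindep : iIndepFun Z μ) (hlaw : ∀ i, μ.map (Z i) = P)
    {ι : Type*} {φ : ℕ → Ω → ι → S → ℝ} (hφ : WithProbTendingToOne μ fun n ω => ∀ i, φ n ω i ∈ Φ)
    (hvar : ∀ ρ : ℝ, 0 < ρ → WithProbTendingToOne μ fun n ω => ∀ i, Var[φ n ω i; P] ≤ ρ)
    {ε : ℝ} (hε : 0 < ε) :
    WithProbTendingToOne μ fun n ω =>
      ∀ i, |√n * (empMean (sample Z n ω) (φ n ω i) - ∫ s, φ n ω i s ∂P)| ≤ ε := by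
  refine withProbTendingToOne_iff_measureReal.2 fun η hη => ?_
  obtain ⟨ρ, hρ, hpi⟩ := h.exists_eventually_measureReal_lt hε (half_pos hη)
  filter_upwards [hpi, withProbTendingToOne_iff_measureReal.1 (hφ.and (hvar ρ hρ)) _ (half_pos hη)]
    with n hn hbad
  set A : Set (Fin n → S) :=
    {z | ∃ φ ∈ Φ, Var[φ; P] ≤ ρ ∧ ε < |√n * (empMean z φ - ∫ s, φ s ∂P)|}
  set bad : Set Ω := {ω | ¬ ((∀ i, φ n ω i ∈ Φ) ∧ ∀ i, Var[φ n ω i; P] ≤ ρ)}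
  have hsub : {ω | ¬ ∀ i, |√n * (empMean (sample Z n ω) (φ n ω i) - ∫ s, φ n ω i s ∂P)| ≤ ε} ⊆
      bad ∪ {ω | sample Z n ω ∈ A} := by
    intro ω hω
    obtain ⟨i, hi⟩ := not_forall.1 hω
    refine (em' _).imp_right fun hgood => ?_
    exact ⟨φ n ω i, hgood.1 i, hgood.2 i, not_le.1 hi⟩
  calc _ ≤ μ.real bad + μ.real {ω | sample Z n ω ∈ A} :=
        (measureReal_mono hsub).trans (measureReal_union_le _ _)
    _ ≤ η / 2 + η / 2 :=
        add_le_add hbad ((measureReal_sample_mem_le hZ hindep hlaw n A).trans hn.le)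
    _ = η := add_halves η

end Donsker

/-! ### Vanishing variances -/

section Variance

variable {S : Type*} [MeasurableSpace S] {P : Measure S}

theorem eq_zero_of_tendsto_mul {d v : ℕ → ℝ} {H : ℝ} (hd : Tendsto d atTop (𝓝 0))
    (hdv : Tendsto (fun k => d k * v k) atTop (𝓝 H))
    (hbdd : ∀ j, liminf (fun k => ‖d j * v k‖ₑ) atTop < ∞) : H = 0 := by
  by_contra hH
  have hdv_ne : ∀ᶠ k in atTop, d k * v k ≠ 0 := hdv.eventually_ne hH
  have hd_ne : ∀ᶠ k in atTop, d k ≠ 0 := hdv_ne.mono fun k hk => left_ne_zero_of_mul hk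
  obtain ⟨j, hj⟩ := hd_ne.exists
  have hd_inv : Tendsto (fun k => |d k|⁻¹) atTop atTop :=
    tendsto_inv_nhdsGT_zero.comp (tendsto_nhdsWithin_iff.2
      ⟨by simpa using hd.abs, hd_ne.mono fun k hk => abs_pos.2 hk⟩)
  have hlim : Tendsto (fun k => |d j| * |d k * v k| * |d k|⁻¹) atTop atTop :=
    Tendsto.pos_mul_atTop (mul_pos (abs_pos.2 hj) (abs_pos.2 hH)) (hdv.abs.const_mul _) hd_inv
  have habs : Tendsto (fun k => |d j * v k|) atTop atTop := by
    refine hlim.congr' (hd_ne.mono fun k hk => ?_)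
    have hk_abs := abs_ne_zero.2 hk
    simp only [abs_mul]
    field_simp
  have htop : Tendsto (fun k => ‖d j * v k‖ₑ) atTop (𝓝 ∞) := by
    simpa only [Real.enorm_eq_ofReal_abs] using! ENNReal.tendsto_ofReal_atTop.comp habs
  exact (hbdd j).ne htop.liminf_eq

theorem ae_eq_zero_of_tendstoInMeasure_mul {d v : ℕ → S → ℝ} {H : S → ℝ} {p : ℝ≥0∞} (hp : p ≠ 0)
    {R : NNReal} (hd : TendstoInMeasure P d atTop fun _ => 0)
    (hdv : TendstoInMeasure P (fun k s => d k s * v k s) atTop H)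
    (hmeas : ∀ j k, Measurable fun s => d j s * v k s)
    (hbdd : ∀ j k, eLpNorm (fun s => d j s * v k s) p P ≤ R) : H =ᵐ[P] 0 := by
  obtain ⟨σ, hσ, hσ_lim⟩ := hd.exists_seq_tendsto_ae
  obtain ⟨τ, hτ, hτ_lim⟩ := (hdv.comp hσ.tendsto_atTop).exists_seq_tendsto_ae
  have hliminf (j : ℕ) : ∀ᵐ s ∂P, liminf (fun k => ‖d j s * v (σ (τ k)) s‖ₑ) atTop < ∞ :=
    ae_bdd_liminf_atTop_of_eLpNorm_bdd hp (fun k => hmeas j _) fun k => hbdd j _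
  filter_upwards [hσ_lim, hτ_lim, ae_all_iff.2 hliminf] with s hds hdvs hliminfs
  exact eq_zero_of_tendsto_mul (hds.comp hτ.tendsto_atTop) hdvs fun j => hliminfs (σ (τ j))

theorem tendstoInMeasure_of_eLpNorm_sub_le {h : ℕ → S → ℝ} {H : S → ℝ} {b : ℕ → ℝ≥0∞}
    (hh : ∀ k, AEStronglyMeasurable (h k) P) (hH : AEStronglyMeasurable H P)
    (hb : Tendsto b atTop (𝓝 0)) (hle : ∀ k, eLpNorm (h k - H) 1 P ≤ b k) :
    TendstoInMeasure P h atTop H :=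
  tendstoInMeasure_of_tendsto_eLpNorm one_ne_zero hh hH
    (tendsto_of_tendsto_of_tendsto_of_le_of_le tendsto_const_nhds hb (fun _ => zero_le) hle)

variable [IsProbabilityMeasure P]

theorem eLpNorm_sub_coeFn_le {h : S → ℝ} (hh : AEStronglyMeasurable h P) (g G : Lp ℝ 2 P) :
    eLpNorm (h - ⇑G) 1 P ≤ eLpNorm (h - ⇑g) 1 P + ‖g - G‖ₑ := by
  have hg := Lp.aestronglyMeasurable g
  have hG := Lp.aestronglyMeasurable G
  rw [← sub_add_sub_cancel h ⇑g ⇑G]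
  refine (eLpNorm_add_le (hh.sub hg) (hg.sub hG) le_rfl).trans (add_le_add_right ?_ _)
  rw [Lp.enorm_def, ← eLpNorm_congr_ae (Lp.coeFn_sub g G)]
  exact eLpNorm_le_eLpNorm_of_exponent_le one_le_two (Lp.aestronglyMeasurable _)

/-- The diagonal `g k k` has a limit point, to which `d k * v k` converges as well; that limit
vanishes because the `d j * v k` stay bounded in `L¹` although `d k` tends to zero. -/
theorem exists_norm_lt_of_eLpNorm_mul_sub_le {T : Set (Lp ℝ 2 P)} (hT : TotallyBounded T)
    {g : ℕ → ℕ → Lp ℝ 2 P} (hg : ∀ j k, g j k ∈ T) {d v : ℕ → S → ℝ} {b : ℕ → ℝ}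
    (hd : ∀ j, Measurable (d j)) (hv : ∀ k, Measurable (v k)) (hb : Tendsto b atTop (𝓝 0))
    (hdb : ∀ j, eLpNorm (d j) 1 P ≤ ENNReal.ofReal (b j))
    (hgb : ∀ j k, eLpNorm ((fun s => d j s * v k s) - ⇑(g j k)) 1 P ≤ ENNReal.ofReal (b j))
    {ε : ℝ} (hε : 0 < ε) : ∃ k, ‖g k k‖ < ε := by
  obtain ⟨H, -, σ, hσ, hlim⟩ := (hT.closure.isCompact_of_isClosed isClosed_closure).tendsto_subseq
    fun k => subset_closure (hg k k)
  obtain ⟨C, -, hC⟩ := hT.isBounded.exists_pos_norm_le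
  obtain ⟨b', hb'⟩ := hb.bddAbove_range
  have hbσ : Tendsto (fun k => ENNReal.ofReal (b (σ k))) atTop (𝓝 0) := by
    simpa using ENNReal.tendsto_ofReal (hb.comp hσ.tendsto_atTop)
  have hdv (j k : ℕ) : Measurable fun s => d j s * v k s := (hd j).mul (hv k)
  have hL1 (G : Lp ℝ 2 P) (j k : ℕ) : eLpNorm ((fun s => d j s * v k s) - ⇑G) 1 P ≤
      ENNReal.ofReal (b j) + ‖g j k - G‖ₑ :=
    (eLpNorm_sub_coeFn_le (hdv j k).aestronglyMeasurable (g j k) G).trans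
      (add_le_add_left (hgb j k) _)
  have hd_lim : TendstoInMeasure P (fun k => d (σ k)) atTop 0 :=
    tendstoInMeasure_of_eLpNorm_sub_le (fun k => (hd _).aestronglyMeasurable)
      aestronglyMeasurable_zero hbσ fun k => by simpa only [sub_zero] using hdb (σ k)
  have hdv_lim : TendstoInMeasure P (fun k s => d (σ k) s * v (σ k) s) atTop H :=
    tendstoInMeasure_of_eLpNorm_sub_le (fun k => (hdv _ _).aestronglyMeasurable)
      (Lp.aestronglyMeasurable H)
      (by simpa using hbσ.add (tendsto_iff_enorm_sub_tendsto_zero.1 hlim)) fun k => hL1 H _ _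
  have hbdd (j k : ℕ) : eLpNorm (fun s => d (σ j) s * v (σ k) s) 1 P ≤
      ↑(b'.toNNReal + C.toNNReal) := by
    have hzero := hL1 0 (σ j) (σ k)
    rw [eLpNorm_congr_ae ((ae_eq_refl _).sub (Lp.coeFn_zero ℝ 2 P)), sub_zero, sub_zero,
      ← ofReal_norm] at hzero
    exact hzero.trans (add_le_add (ENNReal.ofReal_le_ofReal (hb' ⟨σ j, rfl⟩))
      (ENNReal.ofReal_le_ofReal (hC _ (hg _ _))))
  have hH : H = 0 := Lp.ext ((ae_eq_zero_of_tendstoInMeasure_mul one_ne_zero hd_lim hdv_lim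
    (fun j k => hdv _ _) hbdd).trans (Lp.coeFn_zero ℝ 2 P).symm)
  rw [hH] at hlim
  obtain ⟨k, hk⟩ := (hlim.norm.eventually_lt_const (by simpa using hε)).exists
  exact ⟨σ k, hk⟩

theorem exists_forall_variance_le_of_totallyBounded {Φ : Set (S → ℝ)}
    (hΦ : ∀ φ ∈ Φ, MemLp φ 2 P) (hT : TotallyBounded (centredClass P Φ)) {ι : Type*}
    {u : ι → S → ℝ} (hu : ∀ i, Measurable (u i)) {ε : ℝ} (hε : 0 < ε) :
    ∃ δ : ℝ, 0 < δ ∧ ∀ (d : S → ℝ) (φ : ι → S → ℝ), Measurable d →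
      eLpNorm d 1 P ≤ ENNReal.ofReal δ → (∀ i, φ i ∈ Φ) →
      (∀ i, eLpNorm (fun s => d s * u i s - (φ i s - ∫ t, φ i t ∂P)) 1 P ≤ ENNReal.ofReal δ) →
      ∀ i, Var[φ i; P] ≤ ε := by
  by_contra! hcon
  choose d φ hd hd_le hφ hφ_le i hvar using fun k : ℕ => hcon (1 / ((k : ℝ) + 1)) (by positivity)
  have hmem (j k : ℕ) : MemLp (fun s => φ j (i k) s - ∫ t, φ j (i k) t ∂P) 2 P :=
    (hΦ _ (hφ j (i k))).sub (memLp_const _)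
  have hcoe (j k : ℕ) := (hmem j k).coeFn_toLp
  have hle (j k : ℕ) : eLpNorm ((fun s => d j s * u (i k) s) - ⇑(hmem j k).toLp) 1 P ≤
      ENNReal.ofReal (1 / ((j : ℝ) + 1)) :=
    (eLpNorm_congr_ae ((ae_eq_refl _).sub (hcoe j k))).trans_le (hφ_le j (i k))
  obtain ⟨k, hk⟩ := exists_norm_lt_of_eLpNorm_mul_sub_le hT
    (fun j k => ⟨_, hφ j (i k), hcoe j k⟩) hd (fun k => hu (i k))
    tendsto_one_div_add_atTop_nhds_zero_nat hd_le hle (Real.sqrt_pos.2 hε)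
  rw [norm_eq_sqrt_variance (hΦ _ (hφ k (i k))).1.aemeasurable (hcoe k k)] at hk
  exact (hvar k).not_gt ((Real.sqrt_lt_sqrt_iff (variance_nonneg _ _)).1 hk)

end Variance

/-! ### Conditional means -/

section CondMean

variable {α β : Type*} [MeasurableSpace α] [MeasurableSpace β] [StandardBorelSpace β] [Nonempty β]
  {P : Measure (α × β)} [IsFiniteMeasure P] {u : α × β → ℝ}

theorem measurable_integral_condKernel (hu : Measurable u) :
    Measurable fun w => ∫ q, u (w, q) ∂(P.condKernel w) :=
  hu.stronglyMeasurable.integral_kernel_prod_right'.measurable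

theorem eLpNorm_integral_condKernel_le {p : ℝ≥0∞} (hp : 1 ≤ p) (hp_top : p ≠ ∞)
    (hu : Measurable u) :
    eLpNorm (fun z : α × β => ∫ q, u (z.1, q) ∂(P.condKernel z.1)) p P ≤ eLpNorm u p P := by
  lift p to NNReal using hp_top
  have hp0 : p ≠ 0 := (zero_lt_one.trans_le (by exact_mod_cast hp)).ne'
  have hm : Measurable fun z : α × β => ∫ q, u (z.1, q) ∂(P.condKernel z.1) :=
    (measurable_integral_condKernel hu).comp measurable_fst
  rw [← ENNReal.rpow_le_rpow_iff (NNReal.coe_pos.2 (pos_iff_ne_zero.2 hp0)),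
    eLpNorm_nnreal_pow_eq_lintegral hp0, eLpNorm_nnreal_pow_eq_lintegral hp0,
    ← Measure.lintegral_condKernel (hm.enorm.pow_const _),
    ← Measure.lintegral_condKernel (hu.enorm.pow_const _)]
  refine lintegral_mono fun w => ?_
  simp only [lintegral_const, measure_univ, mul_one]
  rw [← eLpNorm_nnreal_pow_eq_lintegral hp0]
  gcongr
  exact enorm_integral_le_eLpNorm hp (hu.comp measurable_prodMk_left).aestronglyMeasurable

theorem memLp_integral_condKernel {p : ℝ≥0∞} (hp : 1 ≤ p) (hp_top : p ≠ ∞) (hu : Measurable u)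
    (hu_mem : MemLp u p P) :
    MemLp (fun z : α × β => ∫ q, u (z.1, q) ∂(P.condKernel z.1)) p P :=
  ⟨((measurable_integral_condKernel hu).comp measurable_fst).aestronglyMeasurable,
    (eLpNorm_integral_condKernel_le hp hp_top hu).trans_lt hu_mem.2⟩

theorem integral_mul_sub_integral_condKernel {p q : ℝ≥0∞} [p.HolderTriple q 1] (hp : 1 ≤ p)
    (hp_top : p ≠ ∞) (hu : Measurable u) (hu_mem : MemLp u p P) {v : α → ℝ}
    (hv : MemLp (fun z : α × β => v z.1) q P) :
    ∫ z, v z.1 * (u z - ∫ q, u (z.1, q) ∂(P.condKernel z.1)) ∂P = 0 := by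
  have hvu : Integrable (fun z : α × β => v z.1 * u z) P :=
    memLp_one_iff_integrable.1 (hu_mem.mul' hv)
  have hvm : Integrable (fun z : α × β => v z.1 * ∫ q, u (z.1, q) ∂(P.condKernel z.1)) P :=
    memLp_one_iff_integrable.1 ((memLp_integral_condKernel hp hp_top hu hu_mem).mul' hv)
  simp only [mul_sub]
  rw [integral_sub hvu hvm, ← Measure.integral_condKernel hvu, ← Measure.integral_condKernel hvm]
  simp only [integral_const_mul, integral_const, probReal_univ, one_smul, sub_self]

variable {d₁ d₂ : ℕ} {P : Measure (Obs d₁ d₂)} [IsFiniteMeasure P] {f : Dir d₁ d₂}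

theorem measurable_condMeanY : Measurable (condMeanY P) :=
  measurable_integral_condKernel (u := fun z : Obs d₁ d₂ => z.2.2) (by fun_prop)

theorem memLp_condMeanY (hY : MemLp (fun z : Obs d₁ d₂ => z.2.2) 2 P) :
    MemLp (fun z : Obs d₁ d₂ => condMeanY P z.1) 2 P :=
  memLp_integral_condKernel one_le_two ENNReal.ofNat_ne_top
    (u := fun z : Obs d₁ d₂ => z.2.2) (by fun_prop) hY

theorem integral_mul_sub_condMeanY (hY : MemLp (fun z : Obs d₁ d₂ => z.2.2) 2 P) {v : Cov d₂ → ℝ}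
    (hv : MemLp (fun z : Obs d₁ d₂ => v z.1) 2 P) :
    ∫ z, v z.1 * (z.2.2 - condMeanY P z.1) ∂P = 0 :=
  integral_mul_sub_integral_condKernel one_le_two ENNReal.ofNat_ne_top
    (u := fun z : Obs d₁ d₂ => z.2.2) (by fun_prop) hY hv

theorem measurable_comp_obs (hf : Measurable f) :
    Measurable fun z : Obs d₁ d₂ => f (z.1, z.2.1) :=
  hf.comp (by fun_prop)

theorem measurable_condMeanDir (hf : Measurable f) : Measurable (condMeanDir P f) :=
  measurable_integral_condKernel (measurable_comp_obs hf)

theorem memLp_condMeanDir (hf : Measurable f)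
    (hf_mem : MemLp (fun z : Obs d₁ d₂ => f (z.1, z.2.1)) 2 P) :
    MemLp (fun z : Obs d₁ d₂ => condMeanDir P f z.1) 2 P :=
  memLp_integral_condKernel one_le_two ENNReal.ofNat_ne_top (measurable_comp_obs hf) hf_mem

theorem integral_mul_sub_condMeanDir (hf : Measurable f)
    (hf_mem : MemLp (fun z : Obs d₁ d₂ => f (z.1, z.2.1)) 2 P) {v : Cov d₂ → ℝ}
    (hv : MemLp (fun z : Obs d₁ d₂ => v z.1) 2 P) :
    ∫ z, v z.1 * (f (z.1, z.2.1) - condMeanDir P f z.1) ∂P = 0 :=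
  integral_mul_sub_integral_condKernel one_le_two ENNReal.ofNat_ne_top (measurable_comp_obs hf)
    hf_mem hv

end CondMean

/-! ### Empirical means -/

section EmpMean

variable {S : Type*}

theorem empMean_sub {n : ℕ} (z : Fin n → S) (g h : S → ℝ) :
    empMean z (fun s => g s - h s) = empMean z g - empMean z h := by
  simp only [empMean, Finset.sum_sub_distrib, mul_sub]

theorem empMean_add_const_mul {n : ℕ} (z : Fin n → S) (g h : S → ℝ) (c : ℝ) :
    empMean z (fun s => g s + c * h s) = empMean z g + c * empMean z h := by
  simp only [empMean, Finset.sum_add_distrib, ← Finset.mul_sum]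
  ring

theorem empMean_const {n : ℕ} (z : Fin n → S) (hn : n ≠ 0) (c : ℝ) :
    empMean z (fun _ => c) = c := by
  simp [empMean, hn]

variable [MeasurableSpace S] {P : Measure S} [IsProbabilityMeasure P] {Φ : Set (S → ℝ)}
  {Ω : Type*} [MeasurableSpace Ω] {μ : Measure Ω} [IsProbabilityMeasure μ]

theorem IsDonsker.withProbTendingToOne_abs_empMean_le (h : IsDonsker P Φ) {Z : ℕ → Ω → S}
    (hZ : ∀ i, AEMeasurable (Z i) μ) (hindep : iIndepFun Z μ) (hlaw : ∀ i, μ.map (Z i) = P)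
    {ι : Type*} {F : ℕ → Ω → ι → S → ℝ} {c : ℕ → Ω → ι → ℝ}
    (hmem : WithProbTendingToOne μ fun n ω => ∀ i, (fun s => F n ω i s - c n ω i) ∈ Φ)
    (hvar : ∀ ρ : ℝ, 0 < ρ → WithProbTendingToOne μ fun n ω => ∀ i,
      Var[fun s => F n ω i s - c n ω i; P] ≤ ρ)
    (hmean : ∀ ε : ℝ, 0 < ε → WithProbTendingToOne μ fun n ω => ∀ i,
      |∫ s, F n ω i s ∂P| ≤ ε * (n : ℝ) ^ (-(1 / 2) : ℝ)) {ε : ℝ} (hε : 0 < ε) :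
    WithProbTendingToOne μ fun n ω => ∀ i,
      |empMean (sample Z n ω) (F n ω i)| ≤ ε * (n : ℝ) ^ (-(1 / 2) : ℝ) := by
  refine ((hmem.and (h.withProbTendingToOne_abs_le hZ hindep hlaw hmem hvar (half_pos hε))).and
    (hmean _ (half_pos hε))).mono ?_
  filter_upwards [eventually_ne_atTop 0] with n hn
  rintro ω ⟨⟨hΦω, hemp⟩, hmeanω⟩ i
  have hsqrt : 0 < √(n : ℝ) := Real.sqrt_pos.2 (by positivity)
  have hint : Integrable (F n ω i) P :=
    (((h.1 _ (hΦω i)).2.integrable one_le_two).add (integrable_const (c n ω i))).congr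
      (.of_forall fun _ => sub_add_cancel _ _)
  have hcentred : |empMean (sample Z n ω) (F n ω i) - ∫ s, F n ω i s ∂P| ≤ ε / 2 * (√n)⁻¹ := by
    have hi := hemp i
    rw [empMean_sub, empMean_const _ hn, integral_sub hint (integrable_const _), integral_const,
      probReal_univ, one_smul, sub_sub_sub_cancel_right, abs_mul, abs_of_pos hsqrt] at hi
    rwa [← div_eq_mul_inv, le_div_iff₀ hsqrt, mul_comm]
  have hi := hmeanω i
  rw [Real.rpow_neg (Nat.cast_nonneg n), ← Real.sqrt_eq_rpow] at hi ⊢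
  linarith [abs_sub_abs_le_abs_sub (empMean (sample Z n ω) (F n ω i)) (∫ s, F n ω i s ∂P)]

end EmpMean

section SecondOrder

variable {S : Type*} [MeasurableSpace S] {P : Measure S}

theorem integral_sq_le {d : S → ℝ} {a : ℝ} (ha : 0 ≤ a)
    (h : eLpNorm d 2 P ≤ ENNReal.ofReal a) : ∫ s, d s ^ 2 ∂P ≤ a ^ 2 := by
  refine (ENNReal.ofReal_le_ofReal_iff (by positivity)).1 ((Real.ofReal_le_enorm _).trans ?_)
  calc ‖∫ s, d s ^ 2 ∂P‖ₑ ≤ ∫⁻ s, ‖d s ^ 2‖ₑ ∂P := enorm_integral_le_lintegral_enorm _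
    _ = eLpNorm d 2 P ^ 2 := by
      simpa using! (eLpNorm_nnreal_pow_eq_lintegral (f := d) (μ := P)
        (two_ne_zero (α := NNReal))).symm
    _ ≤ ENNReal.ofReal a ^ 2 := by gcongr
    _ = ENNReal.ofReal (a ^ 2) := (ENNReal.ofReal_pow ha 2).symm

theorem eLpNorm_mul_le_ofReal {g h : S → ℝ} {K δ : ℝ} (hg : AEStronglyMeasurable g P)
    (hh : AEStronglyMeasurable h P) (hK : 0 ≤ K) (hgK : eLpNorm g 2 P ≤ ENNReal.ofReal K)
    (hhδ : eLpNorm h 2 P ≤ ENNReal.ofReal δ) :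
    eLpNorm (fun s => g s * h s) 1 P ≤ ENNReal.ofReal (K * δ) := by
  rw [ENNReal.ofReal_mul hK]
  exact (eLpNorm_smul_le_mul_eLpNorm hh hg).trans (mul_le_mul' hgK hhδ)

theorem eLpNorm_const_mul_add_const_mul_le {e a : S → ℝ} {p : ℝ≥0∞} (hp : 1 ≤ p)
    (he : AEStronglyMeasurable e P) (ha : AEStronglyMeasurable a P) {C c c' : ℝ} (hc : |c| ≤ C)
    (hc' : |c'| ≤ C) :
    eLpNorm (fun s => c * e s + c' * a s) p P ≤
      ENNReal.ofReal C * (eLpNorm e p P + eLpNorm a p P) := by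
  refine (eLpNorm_add_le (he.const_mul c) (ha.const_mul c') hp).trans ?_
  rw [mul_add]
  refine add_le_add ((eLpNorm_const_smul_le (c := c) (f := e)).trans ?_)
    ((eLpNorm_const_smul_le (c := c') (f := a)).trans ?_) <;>
  · rw [Real.enorm_eq_ofReal_abs]
    gcongr

theorem exists_eLpNorm_mul_add_mul_le {e : S → ℝ} (he : MemLp e 2 P) {C : ℝ} (hC : 0 < C) {δ : ℝ}
    (hδ : 0 < δ) : ∃ δ' : ℝ, 0 < δ' ∧ ∀ a γ : S → ℝ, AEStronglyMeasurable a P →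
      AEStronglyMeasurable γ P → eLpNorm a 2 P ≤ ENNReal.ofReal δ' →
      eLpNorm γ 2 P ≤ ENNReal.ofReal δ' → ∀ α₁ α₂ β₁ β₂ : ℝ, |α₁| ≤ C → |α₂| ≤ C → |β₁| ≤ C →
      |β₂| ≤ C → eLpNorm (fun s => (α₁ * e s + α₂ * a s) * a s + (β₁ * e s + β₂ * a s) * γ s) 1 P ≤
        ENNReal.ofReal δ := by
  set K : ℝ := C * ((eLpNorm e 2 P).toReal + 1) with hK
  have hK_pos : 0 < K := by positivity
  refine ⟨min 1 (δ / (2 * K)), by positivity, fun a γ ha hγ haδ hγδ α₁ α₂ β₁ β₂ h₁ h₂ h₃ h₄ => ?_⟩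
  have hlin {c c' : ℝ} (hc : |c| ≤ C) (hc' : |c'| ≤ C) :
      eLpNorm (fun s => c * e s + c' * a s) 2 P ≤ ENNReal.ofReal K := by
    refine (eLpNorm_const_mul_add_const_mul_le one_le_two he.1 ha hc hc').trans ?_
    rw [hK, ENNReal.ofReal_mul hC.le, ENNReal.ofReal_add ENNReal.toReal_nonneg zero_le_one,
      ENNReal.ofReal_toReal he.2.ne]
    gcongr
    exact haδ.trans (ENNReal.ofReal_le_ofReal (min_le_left _ _))
  have hmul {c c' : ℝ} (hc : |c| ≤ C) (hc' : |c'| ≤ C) {h : S → ℝ} (hh : AEStronglyMeasurable h P)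
      (hhδ : eLpNorm h 2 P ≤ ENNReal.ofReal (min 1 (δ / (2 * K)))) :
      eLpNorm (fun s => (c * e s + c' * a s) * h s) 1 P ≤ ENNReal.ofReal (δ / 2) := by
    refine (eLpNorm_mul_le_ofReal ((he.1.const_mul c).add (ha.const_mul c')) hh hK_pos.le
      (hlin hc hc') (hhδ.trans (ENNReal.ofReal_le_ofReal (min_le_right _ _)))).trans_eq ?_
    congr 1
    field_simp
  rw [← add_halves δ, ENNReal.ofReal_add (half_pos hδ).le (half_pos hδ).le]
  exact (eLpNorm_add_le (((he.1.const_mul _).add (ha.const_mul _)).mul ha)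
    (((he.1.const_mul _).add (ha.const_mul _)).mul hγ) le_rfl).trans
    (add_le_add (hmul h₁ h₂ ha haδ) (hmul h₃ h₄ hγ hγδ))

end SecondOrder

/-! ### Errors in the influence function -/

section InfluenceError

variable {d₁ d₂ : ℕ}

/-- The error made in `α {y - m(w)}² + 2 β {y - m(w)} {m_f(w) - f(w, x)}` when `m`, `m_f` replace
the conditional means. For `(α, β) = (1, β)` it is the error in the influence function, up to a
constant, and for `(α, β) = (0, 1)` the error in its slope in `β`. -/
def influenceError (P : Measure (Obs d₁ d₂)) [IsFiniteMeasure P] (m mf : Cov d₂ → ℝ)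
    (f : Dir d₁ d₂) (α β : ℝ) (z : Obs d₁ d₂) : ℝ :=
  α * ((z.2.2 - m z.1) ^ 2 - (z.2.2 - condMeanY P z.1) ^ 2) +
    2 * β * ((z.2.2 - m z.1) * (mf z.1 - f (z.1, z.2.1)) -
      (z.2.2 - condMeanY P z.1) * (condMeanDir P f z.1 - f (z.1, z.2.1)))

variable {P : Measure (Obs d₁ d₂)} [IsProbabilityMeasure P] {m mf : Cov d₂ → ℝ} {f : Dir d₁ d₂}

theorem influenceError_one (β : ℝ) (z : Obs d₁ d₂) :
    influenceError P m mf f 1 β z =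
      influenceError P m mf f 1 0 z + β * influenceError P m mf f 0 1 z := by
  simp only [influenceError]
  ring

theorem influence_sub_influence (G G' : ℝ → ℝ) (z : Obs d₁ d₂) (β : ℝ) :
    influence m mf G f z β - influence (condMeanY P) (condMeanDir P f) G' f z β =
      influenceError P m mf f 1 β z - (G β - G' β) := by
  simp only [influence, sqLoss, influenceError]
  ring

theorem deriv_influence_zero {G : ℝ → ℝ} (hG : DifferentiableAt ℝ G 0) (z : Obs d₁ d₂) :
    deriv (influence m mf G f z) 0 =
      2 * (z.2.2 - m z.1) * (mf z.1 - f (z.1, z.2.1)) - deriv G 0 := by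
  have hloss : HasDerivAt (fun β => z.2.2 - m z.1 - β * f (z.1, z.2.1)) (-f (z.1, z.2.1)) 0 := by
    simpa using ((hasDerivAt_id (0 : ℝ)).mul_const (f (z.1, z.2.1))).const_sub (z.2.2 - m z.1)
  have hlin : HasDerivAt (fun β => 2 * β * (z.2.2 - m z.1) * mf z.1)
      (2 * (z.2.2 - m z.1) * mf z.1) 0 := by
    simpa using (((hasDerivAt_id (0 : ℝ)).const_mul 2).mul_const (z.2.2 - m z.1)).mul_const (mf z.1)
  refine (((hloss.pow 2).add hlin).sub hG.hasDerivAt).deriv.trans ?_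
  ring

theorem deriv_influence_sub_deriv_influence {G G' : ℝ → ℝ} (hG : DifferentiableAt ℝ G 0)
    (hG' : DifferentiableAt ℝ G' 0) (z : Obs d₁ d₂) :
    deriv (influence m mf G f z) 0 - deriv (influence (condMeanY P) (condMeanDir P f) G' f z) 0 =
      influenceError P m mf f 0 1 z - (deriv G 0 - deriv G' 0) := by
  rw [deriv_influence_zero hG, deriv_influence_zero hG', influenceError]
  ring

theorem integral_influenceError (hY : MemLp (fun z : Obs d₁ d₂ => z.2.2) 2 P) (hf : Measurable f)
    (hf_mem : MemLp (fun z : Obs d₁ d₂ => f (z.1, z.2.1)) 2 P)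
    (hm : MemLp (fun z : Obs d₁ d₂ => condMeanY P z.1 - m z.1) 2 P)
    (hmf : MemLp (fun z : Obs d₁ d₂ => condMeanDir P f z.1 - mf z.1) 2 P) (α β : ℝ) :
    ∫ z, influenceError P m mf f α β z ∂P =
      α * ∫ z : Obs d₁ d₂, (condMeanY P z.1 - m z.1) ^ 2 ∂P -
      2 * β * ∫ z : Obs d₁ d₂,
        (condMeanDir P f z.1 - mf z.1) * (condMeanY P z.1 - m z.1) ∂P := by
  have he := hY.sub (memLp_condMeanY hY)
  have hu := hf_mem.sub (memLp_condMeanDir hf hf_mem)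
  have hvY : MemLp (fun z : Obs d₁ d₂ => 2 * α * (condMeanY P z.1 - m z.1) -
      2 * β * (condMeanDir P f z.1 - mf z.1)) 2 P :=
    (hm.const_mul (2 * α)).sub (hmf.const_mul (2 * β))
  have hvf := hm.const_mul (-2 * β)
  have horthY := integral_mul_sub_condMeanY (v := fun w => 2 * α * (condMeanY P w - m w) -
    2 * β * (condMeanDir P f w - mf w)) hY hvY
  have horthf := integral_mul_sub_condMeanDir (v := fun w => -2 * β * (condMeanY P w - m w))
    hf hf_mem hvf
  have hsq := hm.integrable_sq.const_mul α
  have hprod := (hmf.integrable_mul hm).const_mul (2 * β)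
  calc ∫ z, influenceError P m mf f α β z ∂P = _ := integral_congr_ae (.of_forall fun z => ?_)
    _ = _ := integral_add ((hvY.integrable_mul he).add (hvf.integrable_mul hu)) (hsq.sub hprod)
    _ = _ := congrArg₂ (· + ·) (integral_add (hvY.integrable_mul he) (hvf.integrable_mul hu))
      (integral_sub hsq hprod)
    _ = _ := by
      rw [← integral_const_mul, ← integral_const_mul]
      exact (congrArg₂ (· + ·) ((congrArg₂ (· + ·) horthY horthf).trans (add_zero 0)) rfl).trans
        (zero_add _)
  simp only [influenceError, Pi.add_apply, Pi.sub_apply, Pi.mul_apply]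
  ring

theorem influenceError_eq (α β : ℝ) (z : Obs d₁ d₂) :
    influenceError P m mf f α β z =
      (condMeanY P z.1 - m z.1) * (-2 * β * (f (z.1, z.2.1) - condMeanDir P f z.1)) +
      ((2 * α * (z.2.2 - condMeanY P z.1) + α * (condMeanY P z.1 - m z.1)) *
          (condMeanY P z.1 - m z.1) +
        (-2 * β * (z.2.2 - condMeanY P z.1) + -2 * β * (condMeanY P z.1 - m z.1)) *
          (condMeanDir P f z.1 - mf z.1)) := by
  simp only [influenceError]
  ring

theorem exists_eLpNorm_sub_influenceError_le (hY : MemLp (fun z : Obs d₁ d₂ => z.2.2) 2 P)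
    {M : ℝ} (hM : 0 < M) {δ : ℝ} (hδ : 0 < δ) :
    ∃ δ' : ℝ, 0 < δ' ∧ ∀ (m mf : Cov d₂ → ℝ) (f : Dir d₁ d₂), Measurable m → Measurable mf →
      Measurable f → MemLp (fun z : Obs d₁ d₂ => f (z.1, z.2.1)) 2 P →
      eLpNorm (fun z : Obs d₁ d₂ => condMeanY P z.1 - m z.1) 2 P ≤ ENNReal.ofReal δ' →
      eLpNorm (fun z : Obs d₁ d₂ => condMeanDir P f z.1 - mf z.1) 2 P ≤ ENNReal.ofReal δ' →
      ∀ α β c : ℝ, |α| ≤ M → |β| ≤ M →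
      eLpNorm (fun z : Obs d₁ d₂ =>
        (condMeanY P z.1 - m z.1) * (-2 * β * (f (z.1, z.2.1) - condMeanDir P f z.1)) -
          (influenceError P m mf f α β z - c - ∫ z', (influenceError P m mf f α β z' - c) ∂P)) 1 P ≤
        ENNReal.ofReal δ := by
  have he := hY.sub (memLp_condMeanY hY)
  obtain ⟨δ', hδ', hrem⟩ := exists_eLpNorm_mul_add_mul_le he (mul_pos two_pos hM) (half_pos hδ)
  refine ⟨δ', hδ', fun m mf f hm hmf hf hf_mem hmδ hmfδ α β c hα hβ => ?_⟩
  have ha : MemLp (fun z : Obs d₁ d₂ => condMeanY P z.1 - m z.1) 2 P :=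
    ⟨((measurable_condMeanY.comp measurable_fst).sub (hm.comp measurable_fst)).aestronglyMeasurable,
      hmδ.trans_lt ENNReal.ofReal_lt_top⟩
  have hγ : MemLp (fun z : Obs d₁ d₂ => condMeanDir P f z.1 - mf z.1) 2 P :=
    ⟨(((measurable_condMeanDir hf).comp measurable_fst).sub
      (hmf.comp measurable_fst)).aestronglyMeasurable, hmfδ.trans_lt ENNReal.ofReal_lt_top⟩
  have horth : ∫ z : Obs d₁ d₂, (condMeanY P z.1 - m z.1) *
      (-2 * β * (f (z.1, z.2.1) - condMeanDir P f z.1)) ∂P = 0 := by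
    simp only [mul_left_comm _ (-2 * β)]
    rw [integral_const_mul, integral_mul_sub_condMeanDir (v := fun w => condMeanY P w - m w) hf
      hf_mem ha, mul_zero]
  have hα' : |2 * α| ≤ 2 * M ∧ |α| ≤ 2 * M := by
    rw [abs_mul, abs_two]
    constructor <;> linarith
  have hβ' : |-2 * β| ≤ 2 * M := by
    rw [abs_mul, abs_neg, abs_two]
    linarith
  have hR := hrem _ _ ha.1 hγ.1 hmδ hmfδ _ _ _ _ hα'.1 hα'.2 hβ' hβ'
  simp only [influenceError_eq]
  refine (eLpNorm_sub_centred_add_le le_rfl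
    (ha.integrable_mul ((hf_mem.sub (memLp_condMeanDir hf hf_mem)).const_mul _)) horth
    ((((he.const_mul _).add (ha.const_mul _)).integrable_mul ha).add
      (((he.const_mul _).add (ha.const_mul _)).integrable_mul hγ)) c).trans ?_
  calc _ ≤ 2 * ENNReal.ofReal (δ / 2) := mul_le_mul_right hR 2
    _ = ENNReal.ofReal δ := by
      rw [← ENNReal.ofReal_ofNat 2, ← ENNReal.ofReal_mul zero_le_two, mul_div_cancel₀ δ two_ne_zero]

theorem exists_forall_variance_influenceError_le (hY : MemLp (fun z : Obs d₁ d₂ => z.2.2) 2 P)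
    {Φ : Set (Obs d₁ d₂ → ℝ)} (hΦ : IsDonsker P Φ) {ι : Type*} {f : ι → Dir d₁ d₂}
    (hf : ∀ i, Measurable (f i))
    (hf_mem : ∀ i, MemLp (fun z : Obs d₁ d₂ => f i (z.1, z.2.1)) 2 P) {α β : ι → ℝ} {M : ℝ}
    (hM : 0 < M) (hα : ∀ i, |α i| ≤ M) (hβ : ∀ i, |β i| ≤ M) {ε : ℝ} (hε : 0 < ε) :
    ∃ δ : ℝ, 0 < δ ∧ ∀ (m : Cov d₂ → ℝ) (mf : ι → Cov d₂ → ℝ) (c : ι → ℝ),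
      Measurable m → (∀ i, Measurable (mf i)) →
      eLpNorm (fun z : Obs d₁ d₂ => condMeanY P z.1 - m z.1) 2 P ≤ ENNReal.ofReal δ →
      (∀ i, eLpNorm (fun z : Obs d₁ d₂ => condMeanDir P (f i) z.1 - mf i z.1) 2 P ≤
        ENNReal.ofReal δ) →
      (∀ i, (fun z => influenceError P m (mf i) (f i) (α i) (β i) z - c i) ∈ Φ) →
      ∀ i, Var[fun z => influenceError P m (mf i) (f i) (α i) (β i) z - c i; P] ≤ ε := by
  have hu (i : ι) : Measurable fun z : Obs d₁ d₂ =>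
      -2 * β i * (f i (z.1, z.2.1) - condMeanDir P (f i) z.1) :=
    ((measurable_comp_obs (hf i)).sub
      ((measurable_condMeanDir (hf i)).comp measurable_fst)).const_mul _
  obtain ⟨δ₁, hδ₁, hvar⟩ := exists_forall_variance_le_of_totallyBounded
    (fun φ hφ => (hΦ.1 φ hφ).2) hΦ.totallyBounded_centredClass hu hε
  obtain ⟨δ₂, hδ₂, happrox⟩ := exists_eLpNorm_sub_influenceError_le hY hM hδ₁
  refine ⟨min δ₁ δ₂, lt_min hδ₁ hδ₂, fun m mf c hm hmf hmδ hmfδ hmem => ?_⟩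
  have ha : Measurable fun z : Obs d₁ d₂ => condMeanY P z.1 - m z.1 :=
    (measurable_condMeanY.comp measurable_fst).sub (hm.comp measurable_fst)
  have hδ_left := ENNReal.ofReal_le_ofReal (min_le_left δ₁ δ₂)
  have hδ_right := ENNReal.ofReal_le_ofReal (min_le_right δ₁ δ₂)
  exact hvar _ _ ha ((eLpNorm_le_eLpNorm_of_exponent_le one_le_two ha.aestronglyMeasurable).trans
    (hmδ.trans hδ_left)) hmem fun i => happrox m (mf i) (f i) hm (hmf i) (hf i) (hf_mem i)
      (hmδ.trans hδ_right) ((hmfδ i).trans hδ_right) _ _ _ (hα i) (hβ i)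

end InfluenceError

/-! ### Empirical means of the errors -/

section NuisanceRates

variable {d₁ d₂ : ℕ} {Ω : Type*} [MeasurableSpace Ω] {μ : Measure Ω}
  {P : Measure (Obs d₁ d₂)} [IsProbabilityMeasure P] {𝔉 : Set (Dir d₁ d₂)}
  {mY : ℕ → Ω → Cov d₂ → ℝ} {mF : ℕ → Ω → Dir d₁ d₂ → Cov d₂ → ℝ}

/-- The conditions on the estimators of the conditional means: an `n^{-1/4}` rate for that of the
outcome, an `n^{-1/2}` rate for the product of the errors, and consistency, uniformly over `𝔉`. -/
structure NuisanceRates (μ : Measure Ω) (P : Measure (Obs d₁ d₂)) [IsFiniteMeasure P]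
    (𝔉 : Set (Dir d₁ d₂)) (mY : ℕ → Ω → Cov d₂ → ℝ) (mF : ℕ → Ω → Dir d₁ d₂ → Cov d₂ → ℝ) :
    Prop where
  measurable_outcome : ∀ n ω, Measurable (mY n ω)
  measurable_direction : ∀ n ω, ∀ f ∈ 𝔉, Measurable (mF n ω f)
  outcome : IsLittleOP μ
    (fun n ω => eLpNorm (fun z : Obs d₁ d₂ => condMeanY P z.1 - mY n ω z.1) 2 P)
    (fun n => (n : ℝ) ^ (-(1 / 4) : ℝ))
  product : IsLittleOP μ
    (fun n ω => ⨆ f ∈ 𝔉, ENNReal.ofReal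
      |∫ z, (condMeanDir P f z.1 - mF n ω f z.1) * (condMeanY P z.1 - mY n ω z.1) ∂P|)
    (fun n => (n : ℝ) ^ (-(1 / 2) : ℝ))
  direction : IsLittleOP μ
    (fun n ω => ⨆ f ∈ 𝔉, eLpNorm (fun z : Obs d₁ d₂ => condMeanDir P f z.1 - mF n ω f z.1) 2 P)
    (fun _ => 1)

namespace NuisanceRates

theorem withProbTendingToOne_eLpNorm_le (h : NuisanceRates μ P 𝔉 mY mF) {δ : ℝ} (hδ : 0 < δ) :
    WithProbTendingToOne μ fun n ω =>
      eLpNorm (fun z : Obs d₁ d₂ => condMeanY P z.1 - mY n ω z.1) 2 P ≤ ENNReal.ofReal δ ∧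
      ∀ f ∈ 𝔉, eLpNorm (fun z : Obs d₁ d₂ => condMeanDir P f z.1 - mF n ω f z.1) 2 P ≤
        ENNReal.ofReal δ := by
  refine ((isLittleOP_iff.1 h.outcome δ hδ).and (isLittleOP_biSup_iff.1 h.direction δ hδ)).mono ?_
  filter_upwards [eventually_ge_atTop 1] with n hn
  refine fun ω hω => ⟨hω.1.trans (ENNReal.ofReal_le_ofReal (mul_le_of_le_one_right hδ.le ?_)), ?_⟩
  · exact Real.rpow_le_one_of_one_le_of_nonpos (by exact_mod_cast hn) (by norm_num)
  · simpa only [mul_one] using hω.2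

theorem withProbTendingToOne_integral_sq_le (h : NuisanceRates μ P 𝔉 mY mF) {ε : ℝ} (hε : 0 < ε) :
    WithProbTendingToOne μ fun n ω =>
      ∫ z : Obs d₁ d₂, (condMeanY P z.1 - mY n ω z.1) ^ 2 ∂P ≤ ε * (n : ℝ) ^ (-(1 / 2) : ℝ) := by
  refine (isLittleOP_iff.1 h.outcome (√ε) (Real.sqrt_pos.2 hε)).mono (.of_forall fun n ω hω => ?_)
  refine (integral_sq_le (by positivity) hω).trans_eq ?_
  rw [mul_pow, Real.sq_sqrt hε.le, ← Real.rpow_mul_natCast (Nat.cast_nonneg n)]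
  norm_num

variable {ι : Type*} {f : ι → Dir d₁ d₂} {α β : ι → ℝ} {M : ℝ}

theorem withProbTendingToOne_abs_integral_influenceError_le (h : NuisanceRates μ P 𝔉 mY mF)
    (hY : MemLp (fun z : Obs d₁ d₂ => z.2.2) 2 P)
    (h𝔉 : ∀ f ∈ 𝔉, Measurable f ∧ MemLp (fun z : Obs d₁ d₂ => f (z.1, z.2.1)) 2 P)
    (hf : ∀ i, f i ∈ 𝔉) (hM : 0 < M) (hα : ∀ i, |α i| ≤ M) (hβ : ∀ i, |β i| ≤ M) {ε : ℝ}
    (hε : 0 < ε) :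
    WithProbTendingToOne μ fun n ω => ∀ i,
      |∫ z, influenceError P (mY n ω) (mF n ω (f i)) (f i) (α i) (β i) z ∂P| ≤
        ε * (n : ℝ) ^ (-(1 / 2) : ℝ) := by
  obtain ⟨ρ, hρ, hρ_eq⟩ : ∃ ρ : ℝ, 0 < ρ ∧ 3 * M * ρ = ε :=
    ⟨ε / (3 * M), by positivity, mul_div_cancel₀ _ (by positivity)⟩
  refine (((h.withProbTendingToOne_integral_sq_le hρ).and
    (isLittleOP_biSup_iff.1 h.product ρ hρ)).and
    (h.withProbTendingToOne_eLpNorm_le one_pos)).mono (.of_forall ?_)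
  rintro n ω ⟨⟨hsq, hprod⟩, hm, hmf⟩ i
  have hμY := measurable_condMeanY (P := P)
  have hμf := measurable_condMeanDir (P := P) (h𝔉 _ (hf i)).1
  have hmY := h.measurable_outcome n ω
  have hmF := h.measurable_direction n ω _ (hf i)
  have hm_mem : MemLp (fun z : Obs d₁ d₂ => condMeanY P z.1 - mY n ω z.1) 2 P :=
    ⟨by fun_prop, hm.trans_lt ENNReal.ofReal_lt_top⟩
  have hmf_mem : MemLp (fun z : Obs d₁ d₂ => condMeanDir P (f i) z.1 - mF n ω (f i) z.1) 2 P :=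
    ⟨by fun_prop, (hmf _ (hf i)).trans_lt ENNReal.ofReal_lt_top⟩
  rw [← abs_of_nonneg (integral_nonneg fun _ => sq_nonneg _)] at hsq
  have hprod_i := (ENNReal.ofReal_le_ofReal_iff (by positivity)).1 (hprod _ (hf i))
  rw [integral_influenceError hY (h𝔉 _ (hf i)).1 (h𝔉 _ (hf i)).2 hm_mem hmf_mem, ← hρ_eq]
  set r : ℝ := (n : ℝ) ^ (-(1 / 2) : ℝ)
  have : 0 ≤ r := by positivity
  calc _ ≤ |α i| * (ρ * r) + 2 * |β i| * (ρ * r) := by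
        refine (abs_sub _ _).trans ?_
        rw [abs_mul, abs_mul, abs_mul, abs_two]
        gcongr
    _ ≤ M * (ρ * r) + 2 * M * (ρ * r) := by gcongr <;> apply_assumption
    _ = 3 * M * ρ * r := by ring

theorem withProbTendingToOne_abs_empMean_influenceError_le [IsProbabilityMeasure μ]
    (h : NuisanceRates μ P 𝔉 mY mF) {Z : ℕ → Ω → Obs d₁ d₂} (hZ : ∀ i, AEMeasurable (Z i) μ)
    (hindep : iIndepFun Z μ) (hlaw : ∀ i, μ.map (Z i) = P)
    (hY : MemLp (fun z : Obs d₁ d₂ => z.2.2) 2 P)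
    (h𝔉 : ∀ f ∈ 𝔉, Measurable f ∧ MemLp (fun z : Obs d₁ d₂ => f (z.1, z.2.1)) 2 P)
    {Φ : Set (Obs d₁ d₂ → ℝ)} (hΦ : IsDonsker P Φ) (hf : ∀ i, f i ∈ 𝔉) (hM : 0 < M)
    (hα : ∀ i, |α i| ≤ M) (hβ : ∀ i, |β i| ≤ M) {c : ℕ → Ω → ι → ℝ}
    (hmem : WithProbTendingToOne μ fun n ω => ∀ i, (fun z =>
      influenceError P (mY n ω) (mF n ω (f i)) (f i) (α i) (β i) z - c n ω i) ∈ Φ)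
    {ε : ℝ} (hε : 0 < ε) :
    WithProbTendingToOne μ fun n ω => ∀ i,
      |empMean (sample Z n ω) (influenceError P (mY n ω) (mF n ω (f i)) (f i) (α i) (β i))| ≤
        ε * (n : ℝ) ^ (-(1 / 2) : ℝ) := by
  refine hΦ.withProbTendingToOne_abs_empMean_le hZ hindep hlaw hmem (fun ρ hρ => ?_)
    (fun η hη =>
      h.withProbTendingToOne_abs_integral_influenceError_le hY h𝔉 hf hM hα hβ hη) hε
  obtain ⟨δ, hδ, hvar⟩ := exists_forall_variance_influenceError_le hY hΦ
    (fun i => (h𝔉 _ (hf i)).1) (fun i => (h𝔉 _ (hf i)).2) hM hα hβ hρ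
  refine (hmem.and (h.withProbTendingToOne_eLpNorm_le hδ)).mono (.of_forall ?_)
  rintro n ω ⟨hΦω, hm, hmf⟩
  exact hvar (mY n ω) (fun i => mF n ω (f i)) (c n ω) (h.measurable_outcome n ω)
    (fun i => h.measurable_direction n ω _ (hf i)) hm (fun i => hmf _ (hf i)) hΦω

end NuisanceRates

end NuisanceRates

/-! ### The one-step estimator -/

section Smoothness

variable {d₁ d₂ : ℕ} {P : Measure (Obs d₁ d₂)} [IsProbabilityMeasure P] {k : WithTop ℕ∞}

theorem contDiff_empMean {S : Type*} {n : ℕ} (z : Fin n → S) {F : S → ℝ → ℝ}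
    (hF : ∀ s, ContDiff ℝ k (F s)) : ContDiff ℝ k fun β => empMean z fun s => F s β :=
  contDiff_const.mul (ContDiff.sum fun i _ => hF (z i))

theorem contDiff_sqLoss (m : Cov d₂ → ℝ) (f : Dir d₁ d₂) (z : Obs d₁ d₂) :
    ContDiff ℝ k fun β => sqLoss m f β z := by
  unfold sqLoss
  fun_prop

theorem contDiff_influence (m mf : Cov d₂ → ℝ) {G : ℝ → ℝ} (hG : ContDiff ℝ k G) (f : Dir d₁ d₂)
    (z : Obs d₁ d₂) : ContDiff ℝ k (influence m mf G f z) :=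
  ((contDiff_sqLoss m f z).add (by fun_prop)).sub hG

theorem contDiff_goodnessOfFit (hY : MemLp (fun z : Obs d₁ d₂ => z.2.2) 2 P) {f : Dir d₁ d₂}
    (hf_mem : MemLp (fun z : Obs d₁ d₂ => f (z.1, z.2.1)) 2 P) :
    ContDiff ℝ k (goodnessOfFit P f) := by
  have he : MemLp (fun z : Obs d₁ d₂ => z.2.2 - condMeanY P z.1) 2 P :=
    hY.sub (memLp_condMeanY hY)
  have hquad : goodnessOfFit P f = fun β => (∫ z, (z.2.2 - condMeanY P z.1) ^ 2 ∂P) -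
      2 * β * (∫ z, (z.2.2 - condMeanY P z.1) * f (z.1, z.2.1) ∂P) +
      β ^ 2 * ∫ z, f (z.1, z.2.1) ^ 2 ∂P := by
    ext β
    have hcross := (he.integrable_mul hf_mem).const_mul (2 * β)
    rw [← integral_const_mul, ← integral_const_mul]
    refine (integral_congr_ae (.of_forall fun z => ?_)).trans
      ((integral_add (he.integrable_sq.sub hcross) (hf_mem.integrable_sq.const_mul (β ^ 2))).trans
        (congrArg (· + _) (integral_sub he.integrable_sq hcross)))
    simp only [sqLoss, Pi.mul_apply, Pi.sub_apply]
    ring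
  rw [hquad]
  fun_prop

variable {Ω : Type*} (Z : ℕ → Ω → Obs d₁ d₂) (mY : ℕ → Ω → Cov d₂ → ℝ)
  (mF : ℕ → Ω → Dir d₁ d₂ → Cov d₂ → ℝ) (n : ℕ) (ω : Ω) (f : Dir d₁ d₂)

theorem contDiff_plugIn : ContDiff ℝ k (plugIn Z mY n ω f) :=
  contDiff_empMean _ (contDiff_sqLoss (mY n ω) f)

theorem contDiff_oneStep : ContDiff ℝ k (oneStep Z mY mF n ω f) :=
  (contDiff_plugIn Z mY n ω f).add
    (contDiff_empMean _ (contDiff_influence _ _ (contDiff_plugIn Z mY n ω f) f))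

theorem contDiff_remainder_oneStep (hY : MemLp (fun z : Obs d₁ d₂ => z.2.2) 2 P) {f : Dir d₁ d₂}
    (hf_mem : MemLp (fun z : Obs d₁ d₂ => f (z.1, z.2.1)) 2 P) :
    ContDiff ℝ k (remainder Z (oneStep Z mY mF) (goodnessOfFit P) (effInfluence P) n ω f) :=
  have hG := contDiff_goodnessOfFit hY hf_mem
  ((contDiff_oneStep Z mY mF n ω f).sub hG).sub
    (contDiff_empMean _ (contDiff_influence _ _ hG f))

end Smoothness

section OneStep

variable {d₁ d₂ : ℕ} {P : Measure (Obs d₁ d₂)} [IsProbabilityMeasure P] {Ω : Type*}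
  (Z : ℕ → Ω → Obs d₁ d₂) (mY : ℕ → Ω → Cov d₂ → ℝ) (mF : ℕ → Ω → Dir d₁ d₂ → Cov d₂ → ℝ)

theorem agreeAtZero_oneStep (𝔉 : Set (Dir d₁ d₂)) : AgreeAtZero 𝔉 (oneStep Z mY mF) := by
  intro n ω f₁ _ f₂ _ _
  have hloss (f : Dir d₁ d₂) : sqLoss (mY n ω) f 0 = fun z => (z.2.2 - mY n ω z.1) ^ 2 := by
    ext z
    simp [sqLoss]
  simp [oneStep, plugIn, estInfluence, influence, hloss]

variable {n : ℕ} (hn : n ≠ 0) (ω : Ω) (f : Dir d₁ d₂)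
include hn

theorem remainder_oneStep_eq_empMean (β : ℝ) :
    remainder Z (oneStep Z mY mF) (goodnessOfFit P) (effInfluence P) n ω f β =
      empMean (sample Z n ω) (influenceError P (mY n ω) (mF n ω f) f 1 β) := by
  have hdiff := empMean_sub (sample Z n ω) (fun z => estInfluence Z mY mF n ω f z β)
    (fun z => effInfluence P f z β)
  simp only [estInfluence, effInfluence, influence_sub_influence] at hdiff
  rw [empMean_sub, empMean_const _ hn] at hdiff
  simp only [remainder, oneStep, estInfluence, effInfluence]
  linarith

theorem remainder_oneStep_eq_affine :
    remainder Z (oneStep Z mY mF) (goodnessOfFit P) (effInfluence P) n ω f = fun β =>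
      empMean (sample Z n ω) (influenceError P (mY n ω) (mF n ω f) f 1 0) +
        β * empMean (sample Z n ω) (influenceError P (mY n ω) (mF n ω f) f 0 1) := by
  ext β
  rw [remainder_oneStep_eq_empMean Z mY mF hn, ← empMean_add_const_mul]
  exact congrArg _ (funext (influenceError_one β))

theorem deriv_remainder_oneStep :
    deriv (remainder Z (oneStep Z mY mF) (goodnessOfFit P) (effInfluence P) n ω f) = fun _ =>
      empMean (sample Z n ω) (influenceError P (mY n ω) (mF n ω f) f 0 1) := by
  ext β
  rw [remainder_oneStep_eq_affine Z mY mF hn]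
  simp

end OneStep

section Conclusions

variable {d₁ d₂ : ℕ} {Ω : Type*} [MeasurableSpace Ω] {μ : Measure Ω}
  {P : Measure (Obs d₁ d₂)} [IsProbabilityMeasure P] {𝔉 : Set (Dir d₁ d₂)} {B : Set ℝ}
  {Z : ℕ → Ω → Obs d₁ d₂} {mY : ℕ → Ω → Cov d₂ → ℝ} {mF : ℕ → Ω → Dir d₁ d₂ → Cov d₂ → ℝ}

theorem secondDerivConsistent_oneStep (hY : MemLp (fun z : Obs d₁ d₂ => z.2.2) 2 P)
    (h𝔉 : ∀ f ∈ 𝔉, MemLp (fun z : Obs d₁ d₂ => f (z.1, z.2.1)) 2 P) (B : Set ℝ) :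
    SecondDerivConsistent μ Z 𝔉 B (oneStep Z mY mF) (goodnessOfFit P) (effInfluence P) := by
  refine ⟨fun n ω f hf β _ => ⟨(contDiff_oneStep Z mY mF n ω f).differentiable_deriv_two β,
    (contDiff_remainder_oneStep Z mY mF n ω hY (h𝔉 f hf)).differentiable_deriv_two β⟩, ?_⟩
  refine fun ε _ => tendsto_const_nhds.congr' ?_
  filter_upwards [eventually_ne_atTop 0] with n hn
  simp [deriv_remainder_oneStep Z mY mF hn]

variable [IsProbabilityMeasure μ] {Φ : Set (Obs d₁ d₂ → ℝ)}

theorem NuisanceRates.uniformlyAsympLinear_oneStep (h : NuisanceRates μ P 𝔉 mY mF)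
    (hZ : ∀ i, AEMeasurable (Z i) μ) (hindep : iIndepFun Z μ) (hlaw : ∀ i, μ.map (Z i) = P)
    (hY : MemLp (fun z : Obs d₁ d₂ => z.2.2) 2 P)
    (h𝔉 : ∀ f ∈ 𝔉, Measurable f ∧ MemLp (fun z : Obs d₁ d₂ => f (z.1, z.2.1)) 2 P)
    (hB : Bornology.IsBounded B) (hΦ : IsDonsker P Φ)
    (hmem : WithProbTendingToOne μ fun n ω => ∀ f ∈ 𝔉, ∀ β ∈ B,
      (fun z => estInfluence Z mY mF n ω f z β - effInfluence P f z β) ∈ Φ) :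
    UniformlyAsympLinear μ Z 𝔉 B (oneStep Z mY mF) (goodnessOfFit P) (effInfluence P) := by
  obtain ⟨R, hR⟩ := isBounded_iff_forall_norm_le.1 hB
  refine isLittleOP_biSup_iff.2 fun ε hε => ?_
  simp only [iSup₂_le_iff]
  refine (h.withProbTendingToOne_abs_empMean_influenceError_le (ι := 𝔉 ×ˢ B) hZ hindep hlaw hY h𝔉
    hΦ (f := fun i => i.1.1) (α := fun _ => 1) (β := fun i => i.1.2) (M := max 1 R)
    (c := fun n ω i => plugIn Z mY n ω i.1.1 i.1.2 - goodnessOfFit P i.1.1 i.1.2)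
    (fun i => i.2.1) (by positivity) (fun _ => abs_one.trans_le (le_max_left _ _))
    (fun i => (hR _ i.2.2).trans (le_max_right _ _)) (hmem.mono (.of_forall fun n ω hω i => ?_))
    hε).mono ?_
  · simp only [← influence_sub_influence]
    exact hω _ i.2.1 _ i.2.2
  · filter_upwards [eventually_ne_atTop 0] with n hn ω hω f hf β hβ
    rw [remainder_oneStep_eq_empMean Z mY mF hn]
    exact ENNReal.ofReal_le_ofReal (hω ⟨(f, β), hf, hβ⟩)

theorem NuisanceRates.derivAsympLinear_oneStep (h : NuisanceRates μ P 𝔉 mY mF)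
    (hZ : ∀ i, AEMeasurable (Z i) μ) (hindep : iIndepFun Z μ) (hlaw : ∀ i, μ.map (Z i) = P)
    (hY : MemLp (fun z : Obs d₁ d₂ => z.2.2) 2 P)
    (h𝔉 : ∀ f ∈ 𝔉, Measurable f ∧ MemLp (fun z : Obs d₁ d₂ => f (z.1, z.2.1)) 2 P)
    (B : Set ℝ) (hΦ : IsDonsker P Φ)
    (hmem : WithProbTendingToOne μ fun n ω => ∀ f ∈ 𝔉,
      (fun z => deriv (estInfluence Z mY mF n ω f z) 0 - deriv (effInfluence P f z) 0) ∈ Φ) :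
    DerivAsympLinear μ Z 𝔉 B (oneStep Z mY mF) (goodnessOfFit P) (effInfluence P) := by
  refine ⟨fun n ω f hf β _ =>
    ⟨(contDiff_oneStep Z mY mF n ω f).differentiable one_ne_zero β,
      (contDiff_remainder_oneStep Z mY mF n ω hY (h𝔉 f hf).2).differentiable one_ne_zero β⟩, ?_⟩
  refine isLittleOP_biSup_iff.2 fun ε hε => ?_
  simp only [iSup₂_le_iff]
  refine (h.withProbTendingToOne_abs_empMean_influenceError_le (ι := 𝔉) hZ hindep hlaw hY h𝔉 hΦ
    (f := (↑)) (α := fun _ => 0) (β := fun _ => 1)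
    (c := fun n ω f => deriv (plugIn Z mY n ω f) 0 - deriv (goodnessOfFit P f) 0)
    Subtype.prop one_pos (fun _ => abs_zero.trans_le zero_le_one) (fun _ => abs_one.le)
    (hmem.mono (.of_forall fun n ω hω f => ?_)) hε).mono ?_
  · simp only [← deriv_influence_sub_deriv_influence
      ((contDiff_plugIn Z mY n ω f).differentiable one_ne_zero 0)
      ((contDiff_goodnessOfFit hY (h𝔉 f f.2).2).differentiable one_ne_zero 0)]
    exact hω f f.2
  · filter_upwards [eventually_ne_atTop 0] with n hn ω hω f hf β _
    rw [deriv_remainder_oneStep Z mY mF hn]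
    exact ENNReal.ofReal_le_ofReal (hω ⟨f, hf⟩)

end Conclusions

end ImprovementInFit

end

open ImprovementInFit in
theorem lemma2_general {d₁ d₂ : ℕ} {Ω : Type*} [MeasurableSpace Ω] (μ : Measure Ω)
    [IsProbabilityMeasure μ] (P₀ : Measure (Obs d₁ d₂)) [IsProbabilityMeasure P₀]
    (Z : ℕ → Ω → Obs d₁ d₂) (hZ : ∀ i, AEMeasurable (Z i) μ) (hindep : iIndepFun Z μ)
    (hlaw : ∀ i, μ.map (Z i) = P₀)
    (hY : MemLp (fun z : Obs d₁ d₂ => z.2.2) 2 P₀)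
    (𝔉 : Set (Dir d₁ d₂))
    (h𝔉 : ∀ f ∈ 𝔉, Measurable f ∧ MemLp (fun z : Obs d₁ d₂ => f (z.1, z.2.1)) 2 P₀)
    (B : Set ℝ) (hBbdd : Bornology.IsBounded B)
    (mY : ℕ → Ω → Cov d₂ → ℝ) (hmY : ∀ n ω, Measurable (mY n ω))
    (mF : ℕ → Ω → Dir d₁ d₂ → Cov d₂ → ℝ) (hmF : ∀ n ω, ∀ f ∈ 𝔉, Measurable (mF n ω f))
    (hrateY : IsLittleOP μ
      (fun n ω => eLpNorm (fun z : Obs d₁ d₂ => condMeanY P₀ z.1 - mY n ω z.1) 2 P₀)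
      (fun n => (n : ℝ) ^ (-(1 / 4) : ℝ)))
    (hrateProd : IsLittleOP μ
      (fun n ω => ⨆ f ∈ 𝔉, ENNReal.ofReal
        |∫ z, (condMeanDir P₀ f z.1 - mF n ω f z.1) * (condMeanY P₀ z.1 - mY n ω z.1) ∂P₀|)
      (fun n => (n : ℝ) ^ (-(1 / 2) : ℝ)))
    (hconsF : IsLittleOP μ
      (fun n ω => ⨆ f ∈ 𝔉,
        eLpNorm (fun z : Obs d₁ d₂ => condMeanDir P₀ f z.1 - mF n ω f z.1) 2 P₀)
      (fun _ => 1))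
    (Φ Φ' : Set (Obs d₁ d₂ → ℝ)) (hΦ : IsDonsker P₀ Φ) (hΦ' : IsDonsker P₀ Φ')
    (hmem : WithProbTendingToOne μ fun n ω => ∀ f ∈ 𝔉, ∀ β ∈ B,
      (fun z => estInfluence Z mY mF n ω f z β - effInfluence P₀ f z β) ∈ Φ)
    (hmem' : WithProbTendingToOne μ fun n ω => ∀ f ∈ 𝔉,
      (fun z => deriv (estInfluence Z mY mF n ω f z) 0 - deriv (effInfluence P₀ f z) 0) ∈ Φ') :
    AgreeAtZero 𝔉 (oneStep Z mY mF) ∧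
    UniformlyAsympLinear μ Z 𝔉 B (oneStep Z mY mF) (goodnessOfFit P₀) (effInfluence P₀) ∧
    DerivAsympLinear μ Z 𝔉 B (oneStep Z mY mF) (goodnessOfFit P₀) (effInfluence P₀) ∧
    SecondDerivConsistent μ Z 𝔉 B (oneStep Z mY mF) (goodnessOfFit P₀) (effInfluence P₀) :=
  have hrates : NuisanceRates μ P₀ 𝔉 mY mF := ⟨hmY, hmF, hrateY, hrateProd, hconsF⟩
  ⟨agreeAtZero_oneStep Z mY mF 𝔉,
    hrates.uniformlyAsympLinear_oneStep hZ hindep hlaw hY h𝔉 hBbdd hΦ hmem,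
    hrates.derivAsympLinear_oneStep hZ hindep hlaw hY h𝔉 B hΦ' hmem',
    secondDerivConsistent_oneStep hY (fun f hf => (h𝔉 f hf).2) B⟩

open ImprovementInFit in
theorem lemma2 {d₁ d₂ : ℕ} {Ω : Type*} [MeasurableSpace Ω] (μ : Measure Ω) [IsProbabilityMeasure μ]
    -- the i.i.d. observations, with law `P₀`
    (P₀ : Measure (Obs d₁ d₂)) [IsProbabilityMeasure P₀]
    (Z : ℕ → Ω → Obs d₁ d₂) (hZ : ∀ i, Measurable (Z i)) (hindep : iIndepFun Z μ)
    (hlaw : ∀ i, μ.map (Z i) = P₀)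
    (hY : MemLp (fun z : Obs d₁ d₂ => z.2.2) 2 P₀)
    -- the collection of sub-models
    (𝔉 : Set (Dir d₁ d₂))
    (h𝔉 : ∀ f ∈ 𝔉, Measurable f ∧ MemLp (fun z : Obs d₁ d₂ => f (z.1, z.2.1)) 2 P₀)
    (B : Set ℝ) (hBint : B.OrdConnected) (hBsymm : ∀ β ∈ B, -β ∈ B) (hBbdd : Bornology.IsBounded B)
    -- the nuisance estimators
    (mY : ℕ → Ω → Cov d₂ → ℝ) (hmY : ∀ n ω, Measurable (mY n ω))
    (mF : ℕ → Ω → Dir d₁ d₂ → Cov d₂ → ℝ) (hmF : ∀ n ω, ∀ f ∈ 𝔉, Measurable (mF n ω f))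
    -- the `L²` rate for the estimator of the conditional mean of the outcome
    (hrateY : IsLittleOP μ
      (fun n ω => eLpNorm (fun z : Obs d₁ d₂ => condMeanY P₀ z.1 - mY n ω z.1) 2 P₀)
      (fun n => (n : ℝ) ^ (-(1 / 4) : ℝ)))
    -- the rate for the product of the nuisance errors
    (hrateProd : IsLittleOP μ
      (fun n ω => ⨆ f ∈ 𝔉, ENNReal.ofReal
        |∫ z, (condMeanDir P₀ f z.1 - mF n ω f z.1) * (condMeanY P₀ z.1 - mY n ω z.1) ∂P₀|)
      (fun n => (n : ℝ) ^ (-(1 / 2) : ℝ)))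
    -- uniform consistency, without a rate, of the estimators of the conditional means of `f(W, X)`
    (hconsF : IsLittleOP μ
      (fun n ω => ⨆ f ∈ 𝔉,
        eLpNorm (fun z : Obs d₁ d₂ => condMeanDir P₀ f z.1 - mF n ω f z.1) 2 P₀)
      (fun _ => 1))
    -- the complexity constraints
    (Φ Φ' Φ'' : Set (Obs d₁ d₂ → ℝ))
    (hΦ : IsDonsker P₀ Φ) (hΦ' : IsDonsker P₀ Φ') (hΦ'' : IsGlivenkoCantelli P₀ Φ'')
    (hmem : WithProbTendingToOne μ fun n ω => ∀ f ∈ 𝔉, ∀ β ∈ B,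
      (fun z => estInfluence Z mY mF n ω f z β - effInfluence P₀ f z β) ∈ Φ)
    (hmem' : WithProbTendingToOne μ fun n ω => ∀ f ∈ 𝔉,
      (fun z => deriv (estInfluence Z mY mF n ω f z) 0 - deriv (effInfluence P₀ f z) 0) ∈ Φ')
    (hmem'' : WithProbTendingToOne μ fun n ω => ∀ f ∈ 𝔉,
      (fun z => deriv (deriv (estInfluence Z mY mF n ω f z)) 0
        - deriv (deriv (effInfluence P₀ f z)) 0) ∈ Φ'') :
    AgreeAtZero 𝔉 (oneStep Z mY mF) ∧
    UniformlyAsympLinear μ Z 𝔉 B (oneStep Z mY mF) (goodnessOfFit P₀) (effInfluence P₀) ∧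
    DerivAsympLinear μ Z 𝔉 B (oneStep Z mY mF) (goodnessOfFit P₀) (effInfluence P₀) ∧
    SecondDerivConsistent μ Z 𝔉 B (oneStep Z mY mF) (goodnessOfFit P₀) (effInfluence P₀) :=
  lemma2_general μ P₀ Z (fun i => (hZ i).aemeasurable) hindep hlaw hY 𝔉 h𝔉 B hBbdd mY hmY mF hmF
    hrateY hrateProd hconsF Φ Φ' hΦ hΦ' hmem hmem'
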